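/- Let $n\ge 1$ be odd and let $D_n=\langle\sigma,\tau \mid \sigma^n=\tau^2=e,\ \tau\sigma=\sigma^{n-1}\tau\rangle$ be the dihedral group of order $2n$. For a finite group $G$ let $D(G)$ be the quantum double of $\mathbb C[G]$: the $|G|^2$-dimensional complex algebra with basis $gh^*$ ($g,h\in G$), where $g\mapsto g=\sum_h gh^*$ is multiplicative, $g^*h^*=\delta(g,h)h^*$, $\sum_h h^*=1$ and $h^*g=g(g^{-1}hg)^*$. Put $\omega=\exp(2\pi i/n)$. (1) The conjugacy classes of $D_n$ are the following, each listed exactly once, with representative $g_C$, centraliser $Z(g_C)$ and elements $\alpha_s$ satisfying $s=\alpha_s g_C\alpha_s^{-1}$ for all $s\in C$ and $\alpha_{g_C}=e$: - $C=\{e\}$, $g_C=e$, $Z(g_C)=D_n$, $\alpha_e=e$; - $C=\{\sigma^k,\sigma^{-k}\}$ for $1\le k\le\frac{n-1}2$, $g_C=\sigma^k$, $Z(g_C)=\{\sigma^i\mid 0\le i<n\}$, $\alpha_{\sigma^k}=e$, $\alpha_{\sigma^{-k}}=\tau$; - $C=\{\sigma^i\tau\mid 0\le i<n\}$, $g_C=\tau$,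 $Z(g_C)=\{e,\tau\}$, $\alpha_{\sigma^i\tau}=\sigma^{\frac{n+1}2 i}$. (2) Each of the following lists of matrices defines a unique representation of $D(D_n)$. These representations are irreducible and pairwise non-isomorphic, and every irreducible $D(D_n)$-module is isomorphic to one of them. - (a) For each sign: $\sigma=1$, $\tau=\pm1$, $g^*=\delta(g,e)$ (dimension 1). - (b) For $1\le k\le\frac{n-1}2$: $\sigma=\begin{pmatrix}\omega^k&0\\0&\omega^{-k}\end{pmatrix}$, $\tau=\begin{pmatrix}0&1\\1&0\end{pmatrix}$, $g^*=\delta(g,e)I_2$ (dimension 2). - (c) For $0\le j<n$ and $1\le k\le\frac{n-1}2$: $\sigma=\begin{pmatrix}\omega^j&0\\0&\omega^{-j}\end{pmatrix}$, $\tau=\begin{pmatrix}0&1\\1&0\end{pmatrix}$, $(\sigma^k)^*=\begin{pmatrix}1&0\\0&0\end{pmatrix}$, $(\sigma^{-k})^*=\begin{pmatrix}0&0\\0&1\end{pmatrix}$, and $g^*=0$ for all other $g$ (dimension 2). - (d) For each sign: $\sigma=A$, $\tau=\pm B$, where $A,B$ are the $n\times n$ matrices $A_{ij}=\delta(i,j+2)$,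 $B_{ij}=\delta(i+j,2)$, with indices $1\le i,j\le n$ and the equalities of indices taken modulo $n$; $(\sigma^i)^*=0$ and $(\sigma^i\tau)^*=E_{i+1,i+1}$ for $0\le i<n$, where $E_{l,l}$ is the elementary matrix with a single $1$ in position $(l,l)$ (dimension $n$). Each of these representations is induced from an irreducible representation $\beta$, on a space $W$, of the centraliser $Z(g_C)$ of the representative of one class $C$: it is isomorphic to the span of the vectors $v(s)=\alpha_s\otimes v$ ($s\in C$, $v\in W$), with $h^*v(s)=\delta(h,s)v(s)$ and $g\,v(s)=\big(\beta(\alpha_t^{-1}g\alpha_s)v\big)(t)$, $t=gsg^{-1}$. In (a) and (b), $C=\{e\}$ and $\beta$ is the representation of $D_n$ given by the displayed matrices of $\sigma,\tau$; in (c), $C=\{\sigma^k,\sigma^{-k}\}$ and $\beta(\sigma)=\omega^j$; in (d), $C=\{\sigma^i\tau\}$ and $\beta(\tau)=\pm1$. (3) The families (a), (b), (c), (d) consist of $2$, $\frac{n-1}2$, $\frac{n(n-1)}2$ and $2$ representations, respectively. If $n\ge3$, then up to isomorphism $D(D_n)$ has exactly $2$ irreducible representations of dimension $1$, exactly $\frac{n^2-1}2$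 of dimension $2$, exactly $2$ of dimension $n$, and none of any other dimension. The sum of the squares of the dimensions of the listed representations is $4n^2=|D_n|^2=\dim D(D_n)$. -/

import Mathlib

open scoped Matrix

universe u

/-! ### The quantum double of a finite group -/

/-- The underlying space of the quantum double `D(G)` of a finite group `G` over `ℂ`: the complex
vector space with basis the symbols `g h^*` (`g h ∈ G`). The element `a` is
`∑ g h, a g h • (g h^*)`. -/
def QuantumDouble (G : Type u) : Type u := G → G → ℂ

namespace QuantumDouble

noncomputable section

set_option linter.unusedSectionVars false

variable {G : Type u}

instance : AddCommGroup (QuantumDouble G) := inferInstanceAs (AddCommGroup (G → G → ℂ))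

instance : Module ℂ (QuantumDouble G) := inferInstanceAs (Module ℂ (G → G → ℂ))

@[ext] theorem ext {a b : QuantumDouble G} (h : ∀ x y, a x y = b x y) : a = b :=
  funext fun x => funext fun y => h x y

theorem add_coeff (a b : QuantumDouble G) (x y : G) : (a + b) x y = a x y + b x y := rfl

theorem zero_coeff (x y : G) : (0 : QuantumDouble G) x y = 0 := rfl

theorem smul_coeff (c : ℂ) (a : QuantumDouble G) (x y : G) : (c • a) x y = c * a x y := rfl

variable [Group G] [Fintype G] [DecidableEq G]

/-- The product determined by `(g k^*) (g' h^*) = g g' h^*` if `k = g' h g'⁻¹`, and `0` otherwise;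
here `x = g g'`. -/
instance : Mul (QuantumDouble G) :=
  ⟨fun a b x h => ∑ g : G, a g ((g⁻¹ * x) * h * (g⁻¹ * x)⁻¹) * b (g⁻¹ * x) h⟩

/-- The unit is `∑ h, e h^*`. -/
instance : One (QuantumDouble G) := ⟨fun g _ => if g = 1 then 1 else 0⟩

theorem mul_coeff (a b : QuantumDouble G) (x h : G) :
    (a * b) x h = ∑ g : G, a g ((g⁻¹ * x) * h * (g⁻¹ * x)⁻¹) * b (g⁻¹ * x) h := rfl

theorem one_coeff (x h : G) : (1 : QuantumDouble G) x h = if x = 1 then 1 else 0 := rfl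

protected theorem mul_assoc' (a b c : QuantumDouble G) : a * b * c = a * (b * c) := by
  ext x h
  simp only [mul_coeff, Finset.sum_mul, Finset.mul_sum]
  rw [Finset.sum_comm]
  refine Finset.sum_congr rfl fun g _ => ?_
  refine Fintype.sum_equiv (Equiv.mulLeft g⁻¹) _ _ fun k => ?_
  simp [mul_assoc]

instance : Ring (QuantumDouble G) :=
  { (inferInstance : AddCommGroup (QuantumDouble G)) with
    mul := (· * ·)
    one := 1
    mul_assoc := QuantumDouble.mul_assoc'
    one_mul := fun a => by
      ext x h
      simp [mul_coeff, one_coeff]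
    mul_one := fun a => by
      ext x h
      rw [mul_coeff, Finset.sum_eq_single x]
      · simp [one_coeff]
      · intro g _ hg
        rw [one_coeff, if_neg, mul_zero]
        intro h0
        exact hg (inv_mul_eq_one.mp h0)
      · simp
    zero_mul := fun a => by
      ext x h
      simp [mul_coeff, zero_coeff]
    mul_zero := fun a => by
      ext x h
      simp [mul_coeff, zero_coeff]
    left_distrib := fun a b c => by
      ext x h
      simp [mul_coeff, add_coeff, mul_add, Finset.sum_add_distrib]
    right_distrib := fun a b c => by
      ext x h
      simp [mul_coeff, add_coeff, add_mul, Finset.sum_add_distrib] }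

instance : Algebra ℂ (QuantumDouble G) :=
  Algebra.ofModule
    (fun r a b => by
      ext x h
      simp [mul_coeff, smul_coeff, Finset.mul_sum, mul_assoc])
    (fun r a b => by
      ext x h
      simp [mul_coeff, smul_coeff, Finset.mul_sum, mul_left_comm])

/-- The basis element `g h^*` of `D(G)`. -/
def elt (g h : G) : QuantumDouble G := fun x y => if x = g ∧ y = h then 1 else 0

/-- The image in `D(G)` of the group element `g`, namely `g ε = ∑ h, g h^*`. -/
def grp (g : G) : QuantumDouble G := ∑ h : G, elt g h

/-- The image in `D(G)` of the dual basis element `h^*`, namely `e h^*`. -/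
def dual (h : G) : QuantumDouble G := elt 1 h

theorem sum_coeff {ι : Type*} (s : Finset ι) (f : ι → QuantumDouble G) (x y : G) :
    (∑ i ∈ s, f i) x y = ∑ i ∈ s, f i x y := by
  classical
  induction s using Finset.induction_on with
  | empty => simp [zero_coeff]
  | insert a s ha ih => simp [Finset.sum_insert ha, add_coeff, ih]

theorem grp_coeff (g x y : G) : grp g x y = if x = g then 1 else 0 := by
  rw [grp, sum_coeff]
  simp only [elt]
  by_cases hx : x = g <;> simp [hx]

theorem elt_mul_elt (g k g' h : G) :
    elt g k * elt g' h = if k = g' * h * g'⁻¹ then elt (g * g') h else 0 := by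
  ext x y
  rw [mul_coeff, Finset.sum_eq_single g]
  · by_cases hk : k = g' * h * g'⁻¹
    · subst hk
      by_cases hx : x = g * g'
      · subst hx
        by_cases hy : y = h <;> simp [elt, hy]
      · have : g⁻¹ * x ≠ g' := fun h0 => hx (by rw [← h0]; group)
        simp [elt, hx, this]
    · rw [if_neg hk, zero_coeff]
      by_cases h1 : g⁻¹ * x = g' ∧ y = h
      · obtain ⟨h1, h2⟩ := h1
        subst h2
        simp only [elt, h1]
        simp [Ne.symm hk]
      · simp [elt, h1]
  · intro b _ hb
    simp [elt, hb]
  · simp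

theorem grp_mul_dual (g h : G) : grp g * dual h = elt g h := by
  rw [grp, dual, Finset.sum_mul, Finset.sum_eq_single h]
  · simp [elt_mul_elt]
  · intro b _ hb
    simp [elt_mul_elt, hb]
  · simp

theorem dual_mul_grp (g h : G) : dual h * grp g = grp g * dual (g⁻¹ * h * g) := by
  rw [grp_mul_dual, grp, dual, Finset.mul_sum, Finset.sum_eq_single (g⁻¹ * h * g)]
  · rw [elt_mul_elt, if_pos (by group), one_mul]
  · intro b _ hb
    rw [elt_mul_elt, if_neg]
    rintro rfl
    exact hb (by group)
  · simp

theorem dual_mul_dual (g h : G) : dual g * dual h = if g = h then dual h else 0 := by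
  simp [dual, elt_mul_elt]

theorem grp_mul_grp (g h : G) : grp g * grp h = grp (g * h) := by
  ext x y
  rw [mul_coeff, Finset.sum_eq_single g]
  · simp only [grp_coeff, inv_mul_eq_iff_eq_mul]
    simp
  · intro b _ hb
    simp [grp_coeff, hb]
  · simp

theorem grp_one : grp (1 : G) = 1 := by
  ext x y
  rw [grp_coeff, one_coeff]

end

end QuantumDouble

/-! ### Matrix representations and their isomorphism classes -/

/-- The module `ℂ^d` of a matrix representation `ρ : A → M_d(ℂ)`: `a` acts by `v ↦ ρ(a) v`. -/
def RepSpace {A : Type u} [Ring A] [Algebra ℂ A] {d : ℕ}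
    (_ρ : A →ₐ[ℂ] Matrix (Fin d) (Fin d) ℂ) : Type := Fin d → ℂ

namespace RepSpace

variable {A : Type u} [Ring A] [Algebra ℂ A] {d : ℕ} (ρ : A →ₐ[ℂ] Matrix (Fin d) (Fin d) ℂ)

instance : AddCommGroup (RepSpace ρ) := inferInstanceAs (AddCommGroup (Fin d → ℂ))

instance : Module A (RepSpace ρ) where
  smul a v := ρ a *ᵥ (v : Fin d → ℂ)
  one_smul v := (congrArg (fun M => M *ᵥ (show Fin d → ℂ from v)) (map_one ρ)).trans
    (Matrix.one_mulVec _)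
  mul_smul a b v := (congrArg (fun M => M *ᵥ (show Fin d → ℂ from v)) (map_mul ρ a b)).trans
    (Matrix.mulVec_mulVec _ _ _).symm
  smul_zero a := Matrix.mulVec_zero (ρ a)
  smul_add a v w := Matrix.mulVec_add (ρ a) v w
  add_smul a b v := (congrArg (fun M => M *ᵥ (show Fin d → ℂ from v)) (map_add ρ a b)).trans
    (Matrix.add_mulVec _ _ _)
  zero_smul v := (congrArg (fun M => M *ᵥ (show Fin d → ℂ from v)) (map_zero ρ)).trans
    (Matrix.zero_mulVec _)

end RepSpace

/-- Isomorphism of irreducible `d`-dimensional matrix representations of `A`. -/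
def irrepSetoid (A : Type u) [Ring A] [Algebra ℂ A] (d : ℕ) :
    Setoid {ρ : A →ₐ[ℂ] Matrix (Fin d) (Fin d) ℂ // IsSimpleModule A (RepSpace ρ)} where
  r ρ ρ' := Nonempty (RepSpace ρ.1 ≃ₗ[A] RepSpace ρ'.1)
  iseqv :=
    ⟨fun _ => ⟨LinearEquiv.refl _ _⟩, fun ⟨e⟩ => ⟨e.symm⟩, fun ⟨e⟩ ⟨f⟩ => ⟨e.trans f⟩⟩

/-- The set of isomorphism classes of irreducible `d`-dimensional representations of `A`. -/
def IrrepClasses (A : Type u) [Ring A] [Algebra ℂ A] (d : ℕ) : Type u :=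
  Quotient (irrepSetoid A d)

/-- `ρ` is isomorphic to the `D(G)`-module induced from the representation `β` of the centraliser
`Z(g₀)`. The induced module has elements `∑ v(s)`, with `v(s) = α_s ⊗ v`, where `s` runs over the
conjugacy class of `g₀`, `v` over the space `W` of `β`, and `α_s` is an element conjugating `g₀`
to `s`. The actions are `h^* v(s) = δ(h, s) v(s)` and
`g v(s) = (β(α_t⁻¹ g α_s) v)(t)` with `t = g s g⁻¹`. -/
def IsInducedFrom {G : Type u} [Group G] [Fintype G] [DecidableEq G] {d : ℕ}
    (ρ : QuantumDouble G →ₐ[ℂ] Matrix (Fin d) (Fin d) ℂ) (g₀ : G) (α : G → G)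
    {W : Type} [AddCommGroup W] [Module ℂ W]
    (β : Representation ℂ (Subgroup.centralizer {g₀}) W) : Prop :=
  ∃ e : (conjugatesOf g₀ → W) ≃ₗ[ℂ] (Fin d → ℂ),
    ∀ (s : conjugatesOf g₀) (w : W),
      (∀ h : G, ρ (QuantumDouble.dual h) *ᵥ e (Pi.single s w) =
        if h = (s : G) then e (Pi.single s w) else 0) ∧
      ∀ (g : G) (t : conjugatesOf g₀) (z : Subgroup.centralizer {g₀}),
        (t : G) = g * s * g⁻¹ → (z : G) = (α t)⁻¹ * g * α s →
          ρ (QuantumDouble.grp g) *ᵥ e (Pi.single s w) = e (Pi.single t (β z w))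

/-! ### The dihedral group `D_n`, `n` odd -/

namespace DihedralOdd

noncomputable section

/-- The generator `σ` of `D_n`: `σ^n = e`. -/
def sigma (n : ℕ) : DihedralGroup n := DihedralGroup.r 1

/-- The generator `τ` of `D_n`: `τ^2 = e` and `τ σ = σ⁻¹ τ`. -/
def tau (n : ℕ) : DihedralGroup n := DihedralGroup.sr 0

/-- `ω = exp(2 π i / n)`. -/
def omega (n : ℕ) : ℂ := Complex.exp (2 * Real.pi * Complex.I / n)

/-- The integers `k` with `1 ≤ k ≤ (n - 1) / 2`. -/
abbrev RotIdx (n : ℕ) : Type := {k : ℕ // 1 ≤ k ∧ k ≤ (n - 1) / 2}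

/-- Labels of the conjugacy classes `{e}`, `{σ^k, σ^{-k}}` and `{σ^i τ | 0 ≤ i < n}`. -/
inductive ClassIdx (n : ℕ) : Type
  | ident : ClassIdx n
  | rot (k : RotIdx n) : ClassIdx n
  | refl : ClassIdx n

namespace ClassIdx

variable {n : ℕ}

/-- The chosen representative `g_k`. -/
def rep : ClassIdx n → DihedralGroup n
  | ident => 1
  | rot k => sigma n ^ k.1
  | refl => tau n

/-- The listed elements of the class. -/
def elements : ClassIdx n → Set (DihedralGroup n)
  | ident => {1}
  | rot k => {sigma n ^ k.1, (sigma n ^ k.1)⁻¹}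
  | refl => {x | ∃ i : ℕ, i < n ∧ x = sigma n ^ i * tau n}

/-- The listed elements of the centraliser of the representative. -/
def centraliser : ClassIdx n → Set (DihedralGroup n)
  | ident => Set.univ
  | rot _ => {x | ∃ i : ℕ, i < n ∧ x = sigma n ^ i}
  | refl => {1, tau n}

/-- The chosen `α_s` (used only for `s` in the class): `α_e = e`; `α_{σ^k} = e` and
`α_{σ^{-k}} = τ`; `α_{σ^i τ} = σ^{i (n+1)/2}`, where `sr j = σ^i τ` with `i ≡ -j` mod `n`. -/
def alpha : ClassIdx n → DihedralGroup n → DihedralGroup n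
  | ident, _ => 1
  | rot k, s => if s = sigma n ^ k.1 then 1 else tau n
  | refl, .sr j => sigma n ^ ((n + 1) / 2 * (-j).val)
  | refl, .r _ => 1

end ClassIdx

/-- Labels of the listed representations of `D(D_n)`. -/
inductive IrrepIdx (n : ℕ) : Type
  | one (ε : ℤˣ) : IrrepIdx n
  | two (k : RotIdx n) : IrrepIdx n
  | rot (k : RotIdx n) (j : Fin n) : IrrepIdx n
  | refl (ε : ℤˣ) : IrrepIdx n

namespace IrrepIdx

variable {n : ℕ}

/-- The dimension of the representation. -/
def dim : IrrepIdx n → ℕ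
  | one _ => 1
  | two _ => 2
  | rot _ _ => 2
  | refl _ => n

/-- The conjugacy class from which the representation is induced. -/
def cls : IrrepIdx n → ClassIdx n
  | one _ => .ident
  | two _ => .ident
  | rot k _ => .rot k
  | refl _ => .refl

/-- The matrix of `σ`. Rows and columns are numbered from `1` to `d` in the usual notation and by
`Fin d` here, so `i : Fin d` is the row with number `i + 1`. -/
def sigmaMat : (i : IrrepIdx n) → Matrix (Fin i.dim) (Fin i.dim) ℂ
  | one _ => (1 : Matrix (Fin 1) (Fin 1) ℂ)
  | two k => !![omega n ^ (k.1 : ℤ), 0; 0, omega n ^ (-(k.1 : ℤ))]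
  | rot _ j => !![omega n ^ ((j : ℕ) : ℤ), 0; 0, omega n ^ (-((j : ℕ) : ℤ))]
  | refl _ => Matrix.of fun i j : Fin n =>
      if (i : ℕ) + 1 ≡ ((j : ℕ) + 1) + 2 [MOD n] then (1 : ℂ) else 0

/-- The matrix of `τ`. -/
def tauMat : (i : IrrepIdx n) → Matrix (Fin i.dim) (Fin i.dim) ℂ
  | one ε => (((ε : ℤ) : ℂ) • (1 : Matrix (Fin 1) (Fin 1) ℂ))
  | two _ => !![0, 1; 1, 0]
  | rot _ _ => !![0, 1; 1, 0]
  | refl ε => ((ε : ℤ) : ℂ) • Matrix.of fun i j : Fin n =>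
      if ((i : ℕ) + 1) + ((j : ℕ) + 1) ≡ 2 [MOD n] then (1 : ℂ) else 0

/-- The matrix of `g^*`. In the last case it is the sum of the elementary matrices `E_{i+1,i+1}`
over the `i`, `0 ≤ i < n`, with `g = σ^i τ`: it is `E_{i+1,i+1}` for `g = σ^i τ`, and `0` if `g`
is a rotation. -/
def dualMat : (i : IrrepIdx n) → DihedralGroup n → Matrix (Fin i.dim) (Fin i.dim) ℂ
  | one _, g => if g = 1 then (1 : Matrix (Fin 1) (Fin 1) ℂ) else 0
  | two _, g => if g = 1 then (1 : Matrix (Fin 2) (Fin 2) ℂ) else 0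
  | rot k _, g =>
      if g = sigma n ^ k.1 then !![1, 0; 0, 0]
      else if g = (sigma n ^ k.1)⁻¹ then !![0, 0; 0, 1]
      else (0 : Matrix (Fin 2) (Fin 2) ℂ)
  | refl _, g => ∑ i : Fin n,
      if g = sigma n ^ (i : ℕ) * tau n then Matrix.single i i (1 : ℂ) else 0

/-- The representation `ρ` of `D(D_n)` has the listed values on `σ`, `τ` and all `g^*`. -/
def Realizes [NeZero n] (i : IrrepIdx n)
    (ρ : QuantumDouble (DihedralGroup n) →ₐ[ℂ] Matrix (Fin i.dim) (Fin i.dim) ℂ) : Prop :=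
  ρ (QuantumDouble.grp (sigma n)) = i.sigmaMat ∧
  ρ (QuantumDouble.grp (tau n)) = i.tauMat ∧
  ∀ g, ρ (QuantumDouble.dual g) = i.dualMat g

/-- The dimension of the representation of the centraliser that is induced. -/
def fibreDim : IrrepIdx n → ℕ
  | one _ => 1
  | two _ => 2
  | rot _ _ => 1
  | refl _ => 1

/-- `β` is the representation of the centraliser that is induced: `σ ↦ 1`, `τ ↦ ±1`, or the
two-dimensional representation `π_k` of `D_n`, for the class of `e`; `σ ↦ ω^j` for the class of
`σ^k`; `τ ↦ ±1` for the class of `τ`. -/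
def IsFibre : (i : IrrepIdx n) →
    Representation ℂ (Subgroup.centralizer {i.cls.rep}) (Fin i.fibreDim → ℂ) → Prop
  | one ε, β => ∀ z : Subgroup.centralizer {(one ε : IrrepIdx n).cls.rep},
      ((z : DihedralGroup n) = sigma n → β z = 1) ∧
      ((z : DihedralGroup n) = tau n → β z = ((ε : ℤ) : ℂ) • 1)
  | two k, β => ∀ z : Subgroup.centralizer {(two k : IrrepIdx n).cls.rep},
      ((z : DihedralGroup n) = sigma n →
        β z = Matrix.toLin' !![omega n ^ (k.1 : ℤ), 0; 0, omega n ^ (-(k.1 : ℤ))]) ∧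
      ((z : DihedralGroup n) = tau n → β z = Matrix.toLin' !![0, 1; 1, 0])
  | rot k j, β => ∀ z : Subgroup.centralizer {(rot k j : IrrepIdx n).cls.rep},
      (z : DihedralGroup n) = sigma n → β z = omega n ^ (j : ℕ) • 1
  | refl ε, β => ∀ z : Subgroup.centralizer {(refl ε : IrrepIdx n).cls.rep},
      (z : DihedralGroup n) = tau n → β z = ((ε : ℤ) : ℂ) • 1

end IrrepIdx

end

end DihedralOdd

/-! A module over `D(G)` is a representation of `G` with a `G`-grading: the `h^*` are orthogonal
idempotents with sum `1`, and the relation between `h^*` and `g` says that `g` carries degree `s` to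
degree `g s g⁻¹`. The part of degree `g₀` is a representation of the centraliser of `g₀`.
Conversely, inducing a representation `β` of that centraliser spreads its space over the conjugacy
class of `g₀` by means of the elements `α_s`.

Three general facts carry the proof. A matrix representation containing an equivariant copy of `β`
in degree `g₀`, and having the right dimension, is induced from `β` (`isInducedFrom_of_injective`).
If `β` is irreducible, so is the induced module (`IsInducedFrom.isSimpleModule`). A nonzero
equivariant map from `β` into the degree `g₀` part of a simple module `V` extends to the induced
module, and if that module is simple too, Schur's lemma makes the extension an isomorphism
(`IsInducedFrom.nonempty_linearEquiv`).

For `D_n` with `n` odd, `2` is invertible modulo `n`; this determines the classes, the centralisers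
and the exponents in `α`. The listed matrices satisfy the relations of `D(D_n)` (`exists_realizes`),
and their fibres are characters or the plane representations of `D_n`. Isomorphic modules have the
same annihilator, so explicit elements of `D(D_n)` separate the list (`eq_of_linearEquiv`).
Completeness does not use the sum of squares: in any simple module, averaging over rotations or over
`τ` yields a vector in the degree of some representative that spans, if necessary together with its
image under `τ`, one of the listed fibres (`exists_linearEquiv_aux`). -/

namespace QuantumDouble

variable {G : Type u} [Group G] [Fintype G] [DecidableEq G]

/-! ### Generators of `D(G)` and its universal property. -/

theorem eq_sum_elt (a : QuantumDouble G) : a = ∑ g, ∑ h, a g h • elt g h := by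
  ext x y
  simp only [sum_coeff, smul_coeff, elt]
  rw [Finset.sum_eq_single x _ (by simp), Finset.sum_eq_single y _ (by simp)]
  · simp
  · intro b _ hb
    simp [hb.symm]
  · intro b _ hb
    simp [hb.symm]

theorem sum_dual : ∑ h : G, dual h = 1 := by
  rw [← grp_one]
  rfl

theorem grp_inv_mul_grp (g : G) : grp g⁻¹ * grp g = 1 := by
  rw [grp_mul_grp, inv_mul_cancel, grp_one]

/-- Translation by `a` moves degree `g₀` to degree `a g₀ a⁻¹`. With `a = α s` this yields the action
of `h^*` on an induced module. -/
theorem dual_mul_grp_mul_dual (h a g₀ : G) :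
    dual h * (grp a * dual g₀) = if h = a * g₀ * a⁻¹ then grp a * dual g₀ else 0 := by
  rw [← mul_assoc, dual_mul_grp, mul_assoc, dual_mul_dual]
  by_cases hh : h = a * g₀ * a⁻¹
  · subst hh
    simp [mul_assoc]
  · rw [if_neg hh, if_neg, mul_zero]
    rintro rfl
    exact hh (by group)

/-- The group `G` inside `D(G)`. -/
noncomputable def grpHom : G →* QuantumDouble G where
  toFun := grp
  map_one' := grp_one
  map_mul' g h := (grp_mul_grp g h).symm

/-- An additive map between `D(G)`-modules that commutes with scalars, with `G` and with the dual
basis is `D(G)`-linear. -/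
theorem map_smul_of_generators {X V : Type*} [AddCommGroup X] [AddCommGroup V]
    [Module ℂ X] [Module ℂ V] [Module (QuantumDouble G) X] [Module (QuantumDouble G) V]
    [IsScalarTower ℂ (QuantumDouble G) X] [IsScalarTower ℂ (QuantumDouble G) V]
    (f : X →ₗ[ℂ] V) (hg : ∀ (g : G) x, f (grp g • x) = grp g • f x)
    (hd : ∀ (h : G) x, f (dual h • x) = dual h • f x) (a : QuantumDouble G) (x : X) :
    f (a • x) = a • f x := by
  rw [eq_sum_elt a]
  simp only [Finset.sum_smul, map_sum, smul_assoc, map_smul, ← grp_mul_dual, mul_smul, hg, hd]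

section Lift

variable {B : Type*} [Ring B] [Algebra ℂ B]

/-- The linear map from `D(G)` sending `g h^*` to `π g * P h`. -/
noncomputable def liftLinear (π : G → B) (P : G → B) : QuantumDouble G →ₗ[ℂ] B where
  toFun a := ∑ g, ∑ h, a g h • (π g * P h)
  map_add' a b := by simp [add_coeff, add_smul, Finset.sum_add_distrib]
  map_smul' c a := by simp [smul_coeff, mul_smul, Finset.smul_sum]

theorem liftLinear_elt (π : G → B) (P : G → B) (g h : G) :
    liftLinear π P (elt g h) = π g * P h := by
  change ∑ x, ∑ y, (if x = g ∧ y = h then (1 : ℂ) else 0) • (π x * P y) = _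
  rw [Finset.sum_eq_single g _ (by simp), Finset.sum_eq_single h _ (by simp)]
  · simp
  · intro b _ hb
    simp [hb]
  · intro b _ hb
    simp [hb]

/-- Both sides are bilinear, so basis elements suffice; there `hc` moves `P k` past `π g'` and `hP`
evaluates the remaining product of idempotents. -/
theorem liftLinear_mul (π : G →* B) (P : G → B)
    (hP : ∀ g h, P g * P h = if g = h then P h else 0)
    (hc : ∀ g h, P h * π g = π g * P (g⁻¹ * h * g)) (a b : QuantumDouble G) :
    liftLinear π P (a * b) = liftLinear π P a * liftLinear π P b := by
  have key : ∀ g k g' h, liftLinear π P (elt g k * elt g' h) =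
      liftLinear π P (elt g k) * liftLinear π P (elt g' h) := by
    intro g k g' h
    rw [elt_mul_elt, liftLinear_elt, liftLinear_elt, mul_assoc (π g), ← mul_assoc (P k),
      hc, mul_assoc (π g'), hP]
    by_cases hk : k = g' * h * g'⁻¹
    · subst hk
      simp [liftLinear_elt, mul_assoc]
    · rw [if_neg hk, if_neg]
      · simp
      · rintro rfl
        exact hk (by group)
  rw [eq_sum_elt a, eq_sum_elt b]
  simp only [Finset.sum_mul, Finset.mul_sum, map_sum, map_smul, smul_mul_assoc, mul_smul_comm, key]

/-- The algebra homomorphism from `D(G)` determined by the images of `G` and of the dual basis. -/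
noncomputable def lift (π : G →* B) (P : G → B)
    (hP : ∀ g h, P g * P h = if g = h then P h else 0) (hsum : ∑ h, P h = 1)
    (hc : ∀ g h, P h * π g = π g * P (g⁻¹ * h * g)) : QuantumDouble G →ₐ[ℂ] B :=
  AlgHom.ofLinearMap (liftLinear π P)
    (by
      rw [← grp_one, grp, map_sum]
      simp [liftLinear_elt, hsum])
    (liftLinear_mul π P hP hc)

theorem lift_grp (π : G →* B) (P : G → B) (hP hsum hc) (g : G) :
    lift π P hP hsum hc (grp g) = π g := by
  change liftLinear π P (grp g) = _
  rw [grp, map_sum]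
  simp only [liftLinear_elt]
  rw [← Finset.mul_sum, hsum, mul_one]

theorem lift_dual (π : G →* B) (P : G → B) (hP hsum hc) (h : G) :
    lift π P hP hsum hc (dual h) = P h := by
  change liftLinear π P (elt 1 h) = _
  rw [liftLinear_elt, map_one, one_mul]

theorem algHom_ext_of_closure {S : Set G} (hS : Submonoid.closure S = ⊤)
    {φ ψ : QuantumDouble G →ₐ[ℂ] B} (hg : ∀ g ∈ S, φ (grp g) = ψ (grp g))
    (hd : ∀ h, φ (dual h) = ψ (dual h)) : φ = ψ := by
  have h1 : (φ : QuantumDouble G →* B).comp grpHom = (ψ : QuantumDouble G →* B).comp grpHom :=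
    MonoidHom.eq_of_eqOn_denseM hS hg
  ext1 a
  rw [eq_sum_elt a]
  simp only [map_sum, map_smul, ← grp_mul_dual, map_mul, hd]
  refine Finset.sum_congr rfl fun g _ => Finset.sum_congr rfl fun h _ => ?_
  rw [show φ (grp g) = ψ (grp g) from DFunLike.congr_fun h1 g]

end Lift
end QuantumDouble

/-! ### Induced modules: recognition, irreducibility and the extension of maps from the fibre. -/

section Induced
open QuantumDouble

instance {A : Type u} [Ring A] [Algebra ℂ A] {d : ℕ}
    (ρ : A →ₐ[ℂ] Matrix (Fin d) (Fin d) ℂ) : Module ℂ (RepSpace ρ) :=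
  inferInstanceAs (Module ℂ (Fin d → ℂ))

instance {A : Type u} [Ring A] [Algebra ℂ A] {d : ℕ}
    (ρ : A →ₐ[ℂ] Matrix (Fin d) (Fin d) ℂ) : IsScalarTower ℂ A (RepSpace ρ) where
  smul_assoc c a v := by
    change ρ (c • a) *ᵥ (show Fin d → ℂ from v) = c • (ρ a *ᵥ (show Fin d → ℂ from v))
    rw [map_smul, Matrix.smul_mulVec]

variable {G : Type u} [Group G] {g₀ : G} {α : G → G}

/-- Both `α t` and `g * α s` conjugate `g₀` to `t = g s g⁻¹`, so their quotient commutes with `g₀`.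
-/
theorem inv_mul_mul_mem_centralizer {g s : G}
    (hα : ∀ s ∈ conjugatesOf g₀, s = α s * g₀ * (α s)⁻¹) (hs : s ∈ conjugatesOf g₀)
    (ht : g * s * g⁻¹ ∈ conjugatesOf g₀) :
    (α (g * s * g⁻¹))⁻¹ * g * α s ∈ Subgroup.centralizer {g₀} := by
  rw [Subgroup.mem_centralizer_singleton_iff]
  have h1 := hα s hs
  have h2 := hα _ ht
  set t := g * s * g⁻¹ with htd
  have h3 : α t * g₀ * (α t)⁻¹ = g * (α s * g₀ * (α s)⁻¹) * g⁻¹ := by rw [← h2, ← h1]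
  have h4 : g₀ = (α t)⁻¹ * (g * (α s * g₀ * (α s)⁻¹) * g⁻¹) * α t := by rw [← h3]; group
  have h5 : (α t)⁻¹ * g * α s * g₀ =
    ((α t)⁻¹ * (g * (α s * g₀ * (α s)⁻¹) * g⁻¹) * α t) * ((α t)⁻¹ * g * α s) := by group
  rw [h5, ← h4]

theorem conj_mem_conjugatesOf {s : G} (g : G) (hs : s ∈ conjugatesOf g₀) :
    g * s * g⁻¹ ∈ conjugatesOf g₀ :=
  IsConj.trans hs (isConj_iff.mpr ⟨g, rfl⟩)

variable [Fintype G] [DecidableEq G] {d : ℕ}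
    {ρ : QuantumDouble G →ₐ[ℂ] Matrix (Fin d) (Fin d) ℂ}
    {W : Type} [AddCommGroup W] [Module ℂ W]
    {β : Representation ℂ (Subgroup.centralizer {g₀}) W}

/-- The translates of `ι W` by the `α s` lie in distinct degrees, so their sum is direct; `hdim`
then says that they fill the whole space. -/
theorem isInducedFrom_of_injective [FiniteDimensional ℂ W]
    (hα : ∀ s ∈ conjugatesOf g₀, s = α s * g₀ * (α s)⁻¹)
    (ι : W →ₗ[ℂ] (Fin d → ℂ)) (hι : Function.Injective ι)
    (hd : ∀ w, ρ (dual g₀) *ᵥ ι w = ι w)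
    (hg : ∀ (z : Subgroup.centralizer {g₀}) w, ρ (grp (z : G)) *ᵥ ι w = ι (β z w))
    (hdim : Nat.card (conjugatesOf g₀) * Module.finrank ℂ W = d) :
    IsInducedFrom ρ g₀ α β := by
  classical
  let F : (conjugatesOf g₀ → W) →ₗ[ℂ] (Fin d → ℂ) :=
    ∑ s : conjugatesOf g₀, (Matrix.toLin' (ρ (grp (α s)))) ∘ₗ ι ∘ₗ LinearMap.proj s
  have hF1 : ∀ s w, F (Pi.single s w) = ρ (grp (α s)) *ᵥ ι w := by
    intro s w
    simp only [F, LinearMap.sum_apply, LinearMap.comp_apply, LinearMap.proj_apply,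
      Matrix.toLin'_apply]
    rw [Finset.sum_eq_single s _ (by simp)]
    · simp
    · intro b _ hb
      simp [Pi.single_eq_of_ne hb]
  have hF2 : ∀ (s : conjugatesOf g₀) w (h : G), ρ (dual h) *ᵥ F (Pi.single s w) =
      if h = (s : G) then F (Pi.single s w) else 0 := by
    intro s w h
    rw [hF1, ← hd, Matrix.mulVec_mulVec, Matrix.mulVec_mulVec, ← map_mul, ← map_mul,
      mul_assoc, dual_mul_grp_mul_dual, ← hα s s.2]
    split_ifs <;> simp
  have hinj : Function.Injective F := by
    rw [injective_iff_map_eq_zero]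
    intro f hf
    funext s
    -- The idempotent of degree `s` isolates one component, and translating back by `(α s)⁻¹`
    -- reduces to injectivity of `ι`.
    have h1 : ρ (dual (s : G)) *ᵥ F f = F (Pi.single s (f s)) := by
      conv_lhs => rw [← Finset.univ_sum_single f]
      rw [map_sum, Matrix.mulVec_sum, Finset.sum_eq_single s _ (by simp)]
      · rw [hF2, if_pos rfl]
      · intro b _ hb
        rw [hF2, if_neg]
        exact fun h => hb (Subtype.ext h.symm)
    rw [hf, Matrix.mulVec_zero, hF1] at h1
    have h2 := congrArg (fun v => ρ (grp (α s)⁻¹) *ᵥ v) h1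
    simp only [Matrix.mulVec_zero, Matrix.mulVec_mulVec, ← map_mul, grp_inv_mul_grp, map_one,
      Matrix.one_mulVec] at h2
    exact hι (by rw [← h2, Pi.zero_apply, map_zero])
  have hfin : Module.finrank ℂ (conjugatesOf g₀ → W) = Module.finrank ℂ (Fin d → ℂ) := by
    rw [Module.finrank_pi_fintype, Finset.sum_const, smul_eq_mul, Module.finrank_fin_fun,
      Finset.card_univ, ← Nat.card_eq_fintype_card, hdim]
  refine ⟨LinearEquiv.ofInjectiveOfFinrankEq F hinj hfin, fun s w => ⟨fun h => ?_, ?_⟩⟩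
  · exact hF2 s w h
  · intro g t z ht hz
    change ρ (grp g) *ᵥ F _ = F _
    rw [hF1, hF1, ← hg, Matrix.mulVec_mulVec, Matrix.mulVec_mulVec, ← map_mul, ← map_mul,
      grp_mul_grp, grp_mul_grp, hz, mul_assoc (α t)⁻¹, mul_inv_cancel_left]

theorem IsInducedFrom.exists_linearEquiv (h : IsInducedFrom ρ g₀ α β) :
    ∃ e : (conjugatesOf g₀ → W) ≃ₗ[ℂ] RepSpace ρ, ∀ (s : conjugatesOf g₀) (w : W),
      (∀ h : G, (dual h : QuantumDouble G) • e (Pi.single s w) =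
        if h = (s : G) then e (Pi.single s w) else 0) ∧
      ∀ (g : G) (t : conjugatesOf g₀) (z : Subgroup.centralizer {g₀}),
        (t : G) = g * s * g⁻¹ → (z : G) = (α t)⁻¹ * g * α s →
          (grp g : QuantumDouble G) • e (Pi.single s w) = e (Pi.single t (β z w)) :=
  h

/-- A nonzero submodule is graded, so it contains a nonzero homogeneous vector, which can be moved
to degree `g₀`. Its part of degree `g₀` is a nonzero subrepresentation of `β`, hence everything, and
the translates by the `α s` generate the module. -/
theorem IsInducedFrom.isSimpleModule (h : IsInducedFrom ρ g₀ α β)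
    (hα : ∀ s ∈ conjugatesOf g₀, s = α s * g₀ * (α s)⁻¹) (hα₁ : α g₀ = 1)
    (hβ : β.IsIrreducible) : IsSimpleModule (QuantumDouble G) (RepSpace ρ) := by
  classical
  obtain ⟨e, he⟩ := h.exists_linearEquiv
  have hbot : ∃ w : W, w ≠ 0 := by
    by_contra! hW
    obtain ⟨x, y, hxy⟩ := hβ.toNontrivial
    exact hxy (Subrepresentation.toSubmodule_injective
      (Submodule.ext fun w => by simp [hW w]))
  let o : conjugatesOf g₀ := ⟨g₀, mem_conjugatesOf_self⟩
  rw [isSimpleModule_iff]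
  have : Nontrivial (Submodule (QuantumDouble G) (RepSpace ρ)) := by
    obtain ⟨w, hw⟩ := hbot
    refine ⟨⊥, ⊤, fun h0 => ?_⟩
    have h1 : e (Pi.single o w) ∈
      (⊥ : Submodule (QuantumDouble G) (RepSpace ρ)) := h0 ▸ Submodule.mem_top
    have h2 : e (Pi.single o w) = 0 := h1
    rw [LinearEquiv.map_eq_zero_iff, Pi.single_eq_zero_iff] at h2
    exact hw h2
  refine ⟨fun N => ?_⟩
  rw [or_iff_not_imp_left]
  intro hN
  let U : Subrepresentation β :=
    { toSubmodule :=
        { carrier := {w | e (Pi.single o w) ∈ N}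
          add_mem' := fun {a b} ha hb => by
            simpa only [Set.mem_ofPred_eq, Pi.single_add, map_add] using N.add_mem ha hb
          zero_mem' := by
            simpa only [Set.mem_ofPred_eq, Pi.single_zero, map_zero] using N.zero_mem
          smul_mem' := fun c w hw => by
            simpa only [Set.mem_ofPred_eq, Pi.single_smul, map_smul]
              using N.smul_of_tower_mem c hw }
      apply_mem_toSubmodule := fun z w hw => by
        have := N.smul_mem (grp (z : G)) hw
        have h1 := (he o w).2 (z : G) o z (by
          have := Subgroup.mem_centralizer_singleton_iff.mp z.2
          simp [o, this]) (by simp [o, hα₁])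
        change e (Pi.single o (β z w)) ∈ N
        rw [← h1]
        exact this }
  obtain ⟨v, hvN, hv⟩ := (Submodule.ne_bot_iff N).mp hN
  obtain ⟨f, rfl⟩ := e.surjective v
  have hf : f ≠ 0 := by
    rintro rfl
    exact hv (map_zero e)
  obtain ⟨s, hs⟩ := Function.ne_iff.mp hf
  have h1 : (dual (s : G) : QuantumDouble G) • e f = e (Pi.single s (f s)) := by
    conv_lhs => rw [← Finset.univ_sum_single f]
    rw [map_sum, Finset.smul_sum, Finset.sum_eq_single s _ (by simp)]
    · rw [(he _ _).1, if_pos rfl]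
    · intro b _ hb
      rw [(he _ _).1, if_neg]
      exact fun h => hb (Subtype.ext h.symm)
  have h2 : f s ∈ U.toSubmodule := by
    -- Since `α g₀ = 1`, moving from `s` to `g₀` by `(α s)⁻¹` involves the centraliser element `1`,
    -- so the vector of `W` is unchanged.
    have h3 := (he s (f s)).2 (α s)⁻¹ o 1 (by
      have h4 : (s : G) * α s = α s * g₀ := eq_mul_inv_iff_mul_eq.mp (hα s s.2)
      rw [inv_inv, mul_assoc, h4, inv_mul_cancel_left]) (by simp [o, hα₁])
    rw [map_one, Module.End.one_apply, ← h1] at h3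
    change e (Pi.single o (f s)) ∈ N
    rw [← h3]
    exact N.smul_mem _ (N.smul_mem _ hvN)
  have hU : U = ⊤ := by
    refine (eq_bot_or_eq_top U).resolve_left fun h0 => ?_
    rw [h0] at h2
    exact hs ((Submodule.mem_bot ℂ).mp h2)
  rw [eq_top_iff]
  rintro x -
  obtain ⟨y, rfl⟩ := e.surjective x
  rw [← Finset.univ_sum_single y, map_sum]
  refine N.sum_mem fun t _ => ?_
  have h4 : y t ∈ U.toSubmodule := by rw [hU]; trivial
  have h5 := (he o (y t)).2 (α t) t 1 (hα t t.2) (by simp [o, hα₁])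
  rw [map_one, Module.End.one_apply] at h5
  rw [← h5]
  exact N.smul_mem (grp (α t)) h4

/-- Frobenius reciprocity: `f` extends by `v(s) ↦ α_s • f v`. The extension is linear over `D(G)`
and nonzero, and Schur's lemma for two simple modules finishes. -/
theorem IsInducedFrom.nonempty_linearEquiv {V : Type*} [AddCommGroup V] [Module ℂ V]
    [Module (QuantumDouble G) V] [IsScalarTower ℂ (QuantumDouble G) V]
    [IsSimpleModule (QuantumDouble G) V] [IsSimpleModule (QuantumDouble G) (RepSpace ρ)]
    (h : IsInducedFrom ρ g₀ α β)
    (hα : ∀ s ∈ conjugatesOf g₀, s = α s * g₀ * (α s)⁻¹)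
    (f : W →ₗ[ℂ] V) (hf : f ≠ 0) (hfd : ∀ w, dual g₀ • f w = f w)
    (hfg : ∀ (z : Subgroup.centralizer {g₀}) w, grp (z : G) • f w = f (β z w)) :
    Nonempty (V ≃ₗ[QuantumDouble G] RepSpace ρ) := by
  classical
  obtain ⟨e, he⟩ := h.exists_linearEquiv
  have : SMulCommClass (QuantumDouble G) ℂ V := IsScalarTower.to_smulCommClass'
  let L : QuantumDouble G → V →ₗ[ℂ] V := fun a => DistribSMul.toLinearMap ℂ V a
  let F : (conjugatesOf g₀ → W) →ₗ[ℂ] V :=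
    ∑ s : conjugatesOf g₀, L (grp (α s)) ∘ₗ f ∘ₗ LinearMap.proj s
  have hF1 : ∀ s w, F (Pi.single s w) = grp (α s) • f w := by
    intro s w
    simp only [F, LinearMap.sum_apply, LinearMap.comp_apply, LinearMap.proj_apply]
    rw [Finset.sum_eq_single s _ (by simp)]
    · simp [L]
    · intro b _ hb
      simp [Pi.single_eq_of_ne hb]
  let F' : RepSpace ρ →ₗ[ℂ] V := F ∘ₗ (e.symm : RepSpace ρ →ₗ[ℂ] _)
  have hF' : ∀ y, F' (e y) = F y := fun y => congrArg F (e.symm_apply_apply y)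
  have hgrp : ∀ (g : G) x, F' (grp g • x) = grp g • F' x := by
    intro g x
    obtain ⟨y, rfl⟩ := e.surjective x
    rw [← Finset.univ_sum_single y, map_sum, Finset.smul_sum, map_sum, map_sum, Finset.smul_sum]
    refine Finset.sum_congr rfl fun s _ => ?_
    have ht := conj_mem_conjugatesOf g s.2
    -- Writing `g * α s = α t * z` with `z` in the centraliser turns equivariance under `g` into the
    -- hypothesis `hfg` for `z`.
    have h1 := (he s (y s)).2 g ⟨_, ht⟩ ⟨_, inv_mul_mul_mem_centralizer hα s.2 ht⟩ rfl rfl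
    rw [h1, hF', hF', hF1, hF1, ← hfg, ← mul_smul, ← mul_smul, grp_mul_grp, grp_mul_grp]
    congr 2
    simp only
    group
  have hdual : ∀ (g : G) x, F' (dual g • x) = dual g • F' x := by
    intro g x
    obtain ⟨y, rfl⟩ := e.surjective x
    rw [← Finset.univ_sum_single y, map_sum, Finset.smul_sum, map_sum, map_sum, Finset.smul_sum]
    refine Finset.sum_congr rfl fun s _ => ?_
    rw [(he s (y s)).1, hF', hF1, ← hfd, ← mul_smul, ← mul_smul, mul_assoc, dual_mul_grp_mul_dual,
      ← hα s s.2]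
    split_ifs
    · rw [hF', hF1, mul_smul, hfd]
    · simp
  let Φ : RepSpace ρ →ₗ[QuantumDouble G] V :=
    { toFun := F', map_add' := F'.map_add,
      map_smul' := fun a x => map_smul_of_generators F' hgrp hdual a x }
  have hΦ : Φ ≠ 0 := by
    intro h0
    apply hf
    ext w
    let o : conjugatesOf g₀ := ⟨g₀, mem_conjugatesOf_self⟩
    have h1 : F' (e (Pi.single o w)) = 0 := DFunLike.congr_fun h0 (e (Pi.single o w))
    rw [hF', hF1] at h1
    have h2 := congrArg (fun v => grp (α g₀)⁻¹ • v) h1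
    rw [LinearMap.zero_apply]
    simpa only [smul_zero, ← mul_smul, grp_inv_mul_grp, one_smul, o] using h2
  exact ⟨(LinearEquiv.ofBijective Φ (LinearMap.bijective_of_ne_zero hΦ)).symm⟩

theorem Representation.isIrreducible_of_finrank_eq_one {K H : Type*} [Monoid H] [Field K]
    {X : Type*} [AddCommGroup X] [Module K X] (β : Representation K H X)
    (h : Module.finrank K X = 1) : β.IsIrreducible := by
  have : IsSimpleModule K X := isSimpleModule_iff_finrank_eq_one.mpr h
  have hne : Nontrivial (Subrepresentation β) := by
    refine ⟨⊥, ⊤, fun h0 => ?_⟩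
    exact bot_ne_top (α := Submodule K X) (congrArg Subrepresentation.toSubmodule h0)
  refine ⟨fun U => ?_⟩
  rcases eq_bot_or_eq_top U.toSubmodule with h0 | h0
  · exact Or.inl (Subrepresentation.toSubmodule_injective h0)
  · exact Or.inr (Subrepresentation.toSubmodule_injective h0)

/-- A matrix representation in which the dual basis vector of the representative `g₀` acts as an
elementary matrix is induced from a character of the centraliser. -/
theorem exists_isInducedFrom_character
    (hα : ∀ s ∈ conjugatesOf g₀, s = α s * g₀ * (α s)⁻¹) (o : Fin d)
    (ho : ρ (dual g₀) = Matrix.single o o 1) (hd : Nat.card (conjugatesOf g₀) = d) :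
    ∃ β : Representation ℂ (Subgroup.centralizer {g₀}) (Fin 1 → ℂ),
      (∀ z, β z = ρ (grp (z : G)) o o • 1) ∧ IsInducedFrom ρ g₀ α β := by
  -- As `z` commutes with `g₀`, its matrix commutes with the elementary matrix at `o`; hence the
  -- basis vector at `o` is an eigenvector, and the eigenvalues form the character.
  have hcol : ∀ z : Subgroup.centralizer {g₀},
      ρ (grp (z : G)) *ᵥ Pi.single o 1 = ρ (grp (z : G)) o o • Pi.single o 1 := by
    intro z
    have hz : (z : G)⁻¹ * g₀ * z = g₀ := by
      rw [mul_assoc, ← Subgroup.mem_centralizer_singleton_iff.mp z.2, inv_mul_cancel_left]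
    have h1 : ρ (grp (z : G)) * Matrix.single o o 1 = Matrix.single o o 1 * ρ (grp (z : G)) := by
      rw [← ho, ← map_mul, ← map_mul, dual_mul_grp, hz]
    ext i
    have h2 := congrFun (congrFun h1 i) o
    by_cases hi : i = o
    · subst hi
      simp
    · simpa [Matrix.single_mul_apply_of_ne, hi] using h2
  let χ : Subgroup.centralizer {g₀} →* ℂ :=
    { toFun := fun z => ρ (grp (z : G)) o o
      map_one' := by simp [grp_one]
      map_mul' := fun z z' => by
        have h1 := hcol (z * z')
        rw [Subgroup.coe_mul, ← grp_mul_grp, map_mul, ← Matrix.mulVec_mulVec, hcol z',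
          Matrix.mulVec_smul, hcol z, smul_smul] at h1
        have h2 := congrFun h1 o
        simp only [Pi.smul_apply, Pi.single_eq_same, smul_eq_mul, mul_one] at h2
        rw [Subgroup.coe_mul, ← grp_mul_grp, map_mul, ← h2, mul_comm] }
  let β : Representation ℂ (Subgroup.centralizer {g₀}) (Fin 1 → ℂ) :=
    (algebraMap ℂ (Module.End ℂ (Fin 1 → ℂ)) : ℂ →* _).comp χ
  have hβ : ∀ z, β z = ρ (grp (z : G)) o o • 1 := fun z =>
    Algebra.algebraMap_eq_smul_one (A := Module.End ℂ (Fin 1 → ℂ)) (χ z)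
  let ι : (Fin 1 → ℂ) →ₗ[ℂ] (Fin d → ℂ) := LinearMap.single ℂ _ o ∘ₗ LinearMap.proj 0
  have hι : ∀ w, ι w = w 0 • Pi.single o 1 := fun w => by
    simp [ι, ← Pi.single_smul]
  refine ⟨β, hβ, isInducedFrom_of_injective hα ι ?_ ?_ ?_
    (by rw [hd, Module.finrank_fin_fun, mul_one])⟩
  · intro v w h
    ext i
    rw [Subsingleton.elim i 0]
    exact Pi.single_injective o h
  · intro w
    rw [hι, ho]
    rw [Matrix.mulVec_smul, Matrix.mulVec_single_one]
    congr 1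
    ext i
    simp [Matrix.single_apply, Pi.single_apply, eq_comm]
  · intro z w
    rw [hι, hι, hβ, Matrix.mulVec_smul, hcol]
    simp [smul_smul, mul_comm]

/-- The representation of the centraliser of the neutral element obtained by restricting `ρ`. -/
noncomputable def restrictGroup (ρ : QuantumDouble G →ₐ[ℂ] Matrix (Fin d) (Fin d) ℂ) :
    Representation ℂ (Subgroup.centralizer {(1 : G)}) (Fin d → ℂ) :=
  ((Matrix.toLinAlgEquiv' : Matrix (Fin d) (Fin d) ℂ ≃ₐ[ℂ] _) : _ →* _).comp
    ((ρ : QuantumDouble G →* Matrix (Fin d) (Fin d) ℂ).comp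
      (grpHom.comp (Subgroup.centralizer {(1 : G)}).subtype))

theorem restrictGroup_apply (ρ : QuantumDouble G →ₐ[ℂ] Matrix (Fin d) (Fin d) ℂ)
    (z : Subgroup.centralizer {(1 : G)}) :
    restrictGroup ρ z = Matrix.toLin' (ρ (grp (z : G))) := rfl

/-- The class of the neutral element is a single point, so induction only puts a representation of
`G` in degree `1`; the choice of `α` is immaterial. -/
theorem isInducedFrom_restrictGroup (h1 : ρ (dual 1) = 1) :
    IsInducedFrom ρ 1 α (restrictGroup ρ) := by
  have hc : conjugatesOf (1 : G) = {1} := by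
    ext x
    exact isConj_one_right
  refine isInducedFrom_of_injective ?_ LinearMap.id Function.injective_id ?_ ?_ ?_
  · intro s hs
    rw [hc, Set.mem_singleton_iff] at hs
    simp [hs]
  · intro w
    rw [h1, Matrix.one_mulVec]
  · intro z w
    rfl
  · rw [hc]
    simp

end Induced

/-! ### Conjugacy classes and centralisers of `D_n`, `n` odd. -/

namespace DihedralOdd
open DihedralGroup
variable {n : ℕ}

theorem sigma_pow (i : ℕ) : sigma n ^ i = r (i : ZMod n) := r_one_pow i

theorem sigma_pow_mul_tau (i : ℕ) : sigma n ^ i * tau n = sr (-(i : ZMod n)) := by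
  rw [sigma_pow, tau, r_mul_sr, zero_sub]

/-- This is the inverse of `2` modulo `n`; all uses of oddness in `ZMod n` as a ring come from it.
-/
theorem half_add_half (hn : Odd n) : (((n + 1) / 2 : ℕ) : ZMod n) + ((n + 1) / 2 : ℕ) = 1 := by
  obtain ⟨m, rfl⟩ := hn
  rw [← Nat.cast_add, show (2 * m + 1 + 1) / 2 + (2 * m + 1 + 1) / 2 = (2 * m + 1) + 1 by omega,
    Nat.cast_add, ZMod.natCast_self, zero_add, Nat.cast_one]

theorem eq_of_add_self_eq (hn : Odd n) {a b : ZMod n} (h : a + a = b + b) : a = b := by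
  have := half_add_half hn
  set c := (((n + 1) / 2 : ℕ) : ZMod n)
  linear_combination (-a + b) * this + c * h

theorem eq_zero_of_eq_neg (hn : Odd n) {a : ZMod n} (h : a = -a) : a = 0 :=
  eq_of_add_self_eq hn (by rw [add_zero]; exact eq_neg_iff_add_eq_zero.mp h)

theorem natCast_ne_zero_of_rotIdx (k : RotIdx n) : ((k.1 : ℕ) : ZMod n) ≠ 0 := by
  have h1 := k.2.1
  have h2 := k.2.2
  rw [Ne, ZMod.natCast_eq_zero_iff]
  exact Nat.not_dvd_of_pos_of_lt h1 (by omega)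

theorem natCast_ne_neg_of_rotIdx (hn : Odd n) (k : RotIdx n) :
    ((k.1 : ℕ) : ZMod n) ≠ -((k.1 : ℕ) : ZMod n) := fun h =>
  natCast_ne_zero_of_rotIdx k (eq_zero_of_eq_neg hn h)

theorem eq_of_rotIdx_cast {k l : RotIdx n} (h : ((k.1 : ℕ) : ZMod n) = (l.1 : ℕ)) : k = l := by
  have h1 := k.2
  have h2 := l.2
  have h3 := (ZMod.natCast_eq_natCast_iff' _ _ _).mp h
  rw [Nat.mod_eq_of_lt (by omega), Nat.mod_eq_of_lt (by omega)] at h3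
  exact Subtype.ext h3

/-- The sum `k + l` lies strictly between `0` and `n`. Thus `k` is determined by `±k` modulo `n`. -/
theorem ne_neg_of_rotIdx_cast {k l : RotIdx n} : ((k.1 : ℕ) : ZMod n) ≠ -(l.1 : ℕ) := by
  intro h
  have h1 := k.2
  have h2 := l.2
  rw [eq_neg_iff_add_eq_zero, ← Nat.cast_add, ZMod.natCast_eq_zero_iff] at h
  exact Nat.not_dvd_of_pos_of_lt (by omega) (by omega) h

/-- Every element of `ZMod n`, `n` odd, is `0` or `±k` with `1 ≤ k ≤ (n - 1) / 2`. -/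
theorem eq_zero_or_rotIdx [NeZero n] (hn : Odd n) (a : ZMod n) :
    a = 0 ∨ ∃ k : RotIdx n, a = (k.1 : ℕ) ∨ a = -(k.1 : ℕ) := by
  have hlt := ZMod.val_lt a
  obtain ⟨m, hm⟩ := hn
  by_cases h0 : a.val = 0
  · exact Or.inl ((ZMod.val_eq_zero a).mp h0)
  right
  by_cases h1 : a.val ≤ (n - 1) / 2
  · exact ⟨⟨a.val, by omega, h1⟩, Or.inl (ZMod.natCast_zmod_val a).symm⟩
  · refine ⟨⟨n - a.val, by omega, by omega⟩, Or.inr ?_⟩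
    simp [Nat.cast_sub hlt.le]

namespace ClassIdx

theorem mem_refl_elements [NeZero n] (x : DihedralGroup n) :
    x ∈ (refl : ClassIdx n).elements ↔ ∃ a, x = sr a := by
  constructor
  · rintro ⟨i, -, rfl⟩
    exact ⟨_, sigma_pow_mul_tau i⟩
  · rintro ⟨a, rfl⟩
    refine ⟨(-a).val, ZMod.val_lt _, ?_⟩
    rw [sigma_pow_mul_tau, ZMod.natCast_zmod_val, neg_neg]

theorem mem_rot_elements (k : RotIdx n) (x : DihedralGroup n) :
    x ∈ (rot k).elements ↔ x = r (k.1 : ZMod n) ∨ x = r (-(k.1 : ZMod n)) := by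
  rw [elements, sigma_pow, inv_r, Set.mem_insert_iff, Set.mem_singleton_iff]

theorem alpha_refl_sr [NeZero n] (a : ZMod n) :
    (refl : ClassIdx n).alpha (sr a) = r ((((n + 1) / 2 : ℕ) : ZMod n) * -a) := by
  rw [alpha, sigma_pow, Nat.cast_mul, ZMod.natCast_zmod_val]

theorem eq_alpha_conj [NeZero n] (hn : Odd n) (c : ClassIdx n) (s : DihedralGroup n)
    (hs : s ∈ c.elements) : s = c.alpha s * c.rep * (c.alpha s)⁻¹ := by
  cases c with
  | ident =>
    rw [elements, Set.mem_singleton_iff] at hs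
    simp [hs, rep]
  | rot k =>
    have hk := natCast_ne_neg_of_rotIdx hn k
    rw [mem_rot_elements] at hs
    rcases hs with rfl | rfl
    · simp [alpha, rep, sigma_pow]
    · have h1 : r (-((k.1 : ℕ) : ZMod n)) ≠ r ((k.1 : ℕ) : ZMod n) := fun h =>
        hk (r.inj h).symm
      simp [alpha, rep, sigma_pow, tau, h1]
  | refl =>
    obtain ⟨a, rfl⟩ := (mem_refl_elements s).mp hs
    rw [alpha_refl_sr, rep, tau, r_mul_sr, inv_r, sr_mul_r]
    congr 1
    -- Conjugating `τ` by `σ^m` gives `σ^{2m} τ`, and `m = i (n+1)/2` satisfies `2m ≡ i`; here `i =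
    -- -a`.
    linear_combination (-a) * half_add_half hn

theorem conjugatesOf_rep [NeZero n] (hn : Odd n) (c : ClassIdx n) :
    conjugatesOf c.rep = c.elements := by
  ext s
  constructor
  · intro hs
    obtain ⟨g, rfl⟩ := isConj_iff.mp hs
    cases c with
    | ident => simp [rep, elements]
    | rot k =>
      rw [mem_rot_elements, rep, sigma_pow]
      rcases g with a | a
      · left; simp
      · right; simp
    | refl =>
      rw [mem_refl_elements, rep, tau]
      rcases g with a | a
      · exact ⟨_, by rw [r_mul_sr, inv_r, sr_mul_r]⟩
      · exact ⟨_, by rw [sr_mul_sr, inv_sr, r_mul_sr]⟩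
  · intro hs
    exact isConj_iff.mpr ⟨_, (eq_alpha_conj hn c s hs).symm⟩

theorem centralizer_rep [NeZero n] (hn : Odd n) (c : ClassIdx n) :
    ((Subgroup.centralizer {c.rep} : Subgroup (DihedralGroup n)) : Set (DihedralGroup n)) =
      c.centraliser := by
  ext g
  rw [SetLike.mem_coe, Subgroup.mem_centralizer_singleton_iff]
  cases c with
  | ident => simp [rep, centraliser]
  | rot k =>
    rw [rep, sigma_pow, centraliser, Set.mem_ofPred_eq]
    rcases g with a | a
    · refine iff_of_true (by simp [add_comm]) ⟨a.val, ZMod.val_lt a, ?_⟩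
      rw [sigma_pow, ZMod.natCast_zmod_val]
    · refine iff_of_false ?_ ?_
      · rw [r_mul_sr, sr_mul_r]
        intro h
        have h1 := sr.inj h
        -- A reflection inverts `σ^k`, so commuting with it would force `k ≡ -k`.
        exact natCast_ne_neg_of_rotIdx hn k (by linear_combination h1)
      · rintro ⟨i, -, h⟩
        rw [sigma_pow] at h
        cases h
  | refl =>
    rw [rep, tau, centraliser, Set.mem_insert_iff, Set.mem_singleton_iff, tau]
    rcases g with a | a
    · rw [r_mul_sr, sr_mul_r, one_def]
      simp only [sr.injEq, r.injEq, reduceCtorEq, or_false, zero_add, zero_sub]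
      exact ⟨fun h => eq_zero_of_eq_neg hn h.symm, fun h => by rw [h, neg_zero]⟩
    · rw [sr_mul_sr, sr_mul_sr, one_def]
      simp only [sr.injEq, r.injEq, reduceCtorEq, false_or, sub_zero, zero_sub]
      exact ⟨fun h => eq_zero_of_eq_neg hn h.symm, fun h => by simp [h]⟩

theorem alpha_rep [NeZero n] (c : ClassIdx n) : c.alpha c.rep = 1 := by
  cases c with
  | ident => rfl
  | rot k => simp [alpha, rep]
  | refl => rw [rep, tau, alpha_refl_sr, neg_zero, mul_zero, r_zero]

theorem exists_mem_elements [NeZero n] (hn : Odd n) (g : DihedralGroup n) :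
    ∃ c : ClassIdx n, g ∈ c.elements := by
  rcases g with a | a
  · rcases eq_zero_or_rotIdx hn a with rfl | ⟨k, hk⟩
    · exact ⟨ident, rfl⟩
    · refine ⟨rot k, (mem_rot_elements _ _).mpr ?_⟩
      rcases hk with rfl | rfl
      · exact Or.inl rfl
      · exact Or.inr rfl
  · exact ⟨refl, (mem_refl_elements _).mpr ⟨a, rfl⟩⟩

theorem bijective_mk_rep [NeZero n] (hn : Odd n) :
    Function.Bijective fun c : ClassIdx n => ConjClasses.mk c.rep := by
  constructor
  · intro c c' h
    have h1 : c'.rep ∈ c.elements := by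
      rw [← conjugatesOf_rep hn]
      exact ConjClasses.mk_eq_mk_iff_isConj.mp h
    cases c with
    | ident =>
      rw [elements, Set.mem_singleton_iff] at h1
      cases c' with
      | ident => rfl
      | rot l =>
        rw [rep, sigma_pow, one_def] at h1
        exact absurd (r.inj h1) (natCast_ne_zero_of_rotIdx l)
      | refl => cases h1
    | rot k =>
      rw [mem_rot_elements] at h1
      cases c' with
      | ident =>
        rw [rep, one_def] at h1
        rcases h1 with h1 | h1
        · exact absurd (r.inj h1).symm (natCast_ne_zero_of_rotIdx k)
        · exact absurd (neg_eq_zero.mp (r.inj h1).symm) (natCast_ne_zero_of_rotIdx k)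
      | rot l =>
        rw [rep, sigma_pow] at h1
        rcases h1 with h1 | h1
        · rw [eq_of_rotIdx_cast (r.inj h1)]
        · exact absurd (r.inj h1) ne_neg_of_rotIdx_cast
      | refl => rcases h1 with h1 | h1 <;> cases h1
    | refl =>
      obtain ⟨a, h1⟩ := (mem_refl_elements _).mp h1
      cases c' with
      | ident => cases h1
      | rot l =>
        rw [rep, sigma_pow] at h1
        cases h1
      | refl => rfl
  · intro C
    obtain ⟨g, rfl⟩ := ConjClasses.exists_rep C
    obtain ⟨c, hc⟩ := exists_mem_elements hn g
    rw [← conjugatesOf_rep hn] at hc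
    exact ⟨c, ConjClasses.mk_eq_mk_iff_isConj.mpr hc⟩

theorem card_conjugatesOf_rot [NeZero n] (hn : Odd n) (k : RotIdx n) :
    Nat.card (conjugatesOf (rot k : ClassIdx n).rep) = 2 := by
  rw [conjugatesOf_rep hn, elements, sigma_pow, inv_r, Nat.card_coe_set_eq, Set.ncard_pair]
  exact fun h => natCast_ne_neg_of_rotIdx hn k (r.inj h)

theorem card_conjugatesOf_refl [NeZero n] (hn : Odd n) :
    Nat.card (conjugatesOf (refl : ClassIdx n).rep) = n := by
  have h1 : (refl : ClassIdx n).elements = Set.range sr := by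
    ext x
    rw [mem_refl_elements]
    exact ⟨fun ⟨a, h⟩ => ⟨a, h.symm⟩, fun ⟨a, h⟩ => ⟨a, h.symm⟩⟩
  rw [conjugatesOf_rep hn, h1, Nat.card_coe_set_eq, ← Set.image_univ,
    Set.ncard_image_of_injective _ fun a b h => sr.inj h, Set.ncard_univ, Nat.card_zmod]

end ClassIdx
end DihedralOdd

/-! ### Representations of `D(G)` from representations of `G` with a compatible grading. -/

namespace QuantumDouble

variable {G : Type u} [Group G] [Fintype G] [DecidableEq G]

theorem exists_algHom_of_group {B : Type*} [Ring B] [Algebra ℂ B] (π : G →* B) :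
    ∃ φ : QuantumDouble G →ₐ[ℂ] B, (∀ g, φ (grp g) = π g) ∧
      ∀ h, φ (dual h) = if h = 1 then 1 else 0 := by
  refine ⟨lift π (fun h => if h = 1 then 1 else 0) ?_ ?_ ?_, fun g => lift_grp _ _ _ _ _ g,
    fun h => lift_dual _ _ _ _ _ h⟩
  · intro g h
    by_cases hg : g = 1 <;> by_cases hh : h = 1 <;> simp [hg, hh]
  · simp
  · intro g h
    have : g⁻¹ * h * g = 1 ↔ h = 1 := by
      rw [mul_assoc, inv_mul_eq_one, right_eq_mul]
    simp only [this]
    split_ifs <;> simp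

variable {ι : Type*} [Fintype ι] [DecidableEq ι]

/-- The basis vector `i` is given degree `x i`. The vanishing condition `hπ` says that `π g` sends
degree `y` to degree `g y g⁻¹`, which is the commutation relation between `h^*` and `g`. -/
theorem exists_algHom_of_graded (x : ι → G)
    (π : G →* Matrix ι ι ℂ) (hπ : ∀ g i j, x i ≠ g * x j * g⁻¹ → π g i j = 0) :
    ∃ φ : QuantumDouble G →ₐ[ℂ] Matrix ι ι ℂ, (∀ g, φ (grp g) = π g) ∧
      ∀ h, φ (dual h) = Matrix.diagonal fun i => if h = x i then 1 else 0 := by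
  refine ⟨lift π (fun h => Matrix.diagonal fun i => if h = x i then 1 else 0) ?_ ?_ ?_,
    fun g => lift_grp _ _ _ _ _ g, fun h => lift_dual _ _ _ _ _ h⟩
  · intro g h
    rw [Matrix.diagonal_mul_diagonal]
    split_ifs with hgh
    · subst hgh
      congr 1
      ext i
      split_ifs <;> simp
    · rw [← Matrix.diagonal_zero]
      congr 1
      ext i
      by_cases hg : g = x i
      · have : h ≠ x i := fun hh => hgh (hg.trans hh.symm)
        simp [this]
      · simp [hg]
  · ext i j
    rw [Matrix.sum_apply]
    by_cases hij : i = j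
    · subst hij
      simp
    · simp [hij]
  · intro g h
    ext i j
    rw [Matrix.diagonal_mul, Matrix.mul_diagonal]
    by_cases hij : x i = g * x j * g⁻¹
    · have : h = x i ↔ g⁻¹ * h * g = x j := by
        rw [hij, eq_mul_inv_iff_mul_eq, mul_assoc, inv_mul_eq_iff_eq_mul]
      simp only [this, mul_comm]
    · simp [hπ g i j hij]

/-- The monomial representation of `G` on the space with basis indexed by a union `x` of
conjugacy classes, twisted by a character `χ`. -/
noncomputable def monomialRep (x : ι → G) (hx : Function.Injective x)
    (hc : ∀ g i, ∃ j, x j = g * x i * g⁻¹) (χ : G →* ℂ) : G →* Matrix ι ι ℂ where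
  toFun g := Matrix.of fun i j => if x i = g * x j * g⁻¹ then χ g else 0
  map_one' := by
    ext i j
    simp [Matrix.one_apply, hx.eq_iff]
  map_mul' g h := by
    ext i j
    obtain ⟨l, hl⟩ := hc h j
    rw [Matrix.mul_apply, Finset.sum_eq_single l _ (by simp)]
    · simp only [Matrix.of_apply, if_pos hl, map_mul, ite_mul, zero_mul]
      rw [hl]
      congr 1
      simp [mul_assoc]
    · intro m _ hm
      have : x m ≠ h * x j * h⁻¹ := fun h0 => hm (hx (h0.trans hl.symm))
      simp [this]

omit [Fintype G] in
theorem monomialRep_apply (x : ι → G) (hx hc) (χ : G →* ℂ) (g : G) (i j : ι) :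
    monomialRep x hx hc χ g i j = if x i = g * x j * g⁻¹ then χ g else 0 := rfl

end QuantumDouble

/-! ### The listed matrices satisfy the relations of `D(D_n)`. -/

namespace DihedralOdd
open DihedralGroup QuantumDouble
variable {n : ℕ}

/-- The character of `D_n` with `σ ↦ 1` and `τ ↦ ε`. -/
noncomputable def signChar (n : ℕ) (ε : ℤˣ) : DihedralGroup n →* ℂ where
  toFun
    | r _ => 1
    | sr _ => ((ε : ℤ) : ℂ)
  map_one' := rfl
  map_mul' g h := by
    rcases g with a | a <;> rcases h with b | b <;> rcases Int.units_eq_one_or ε with rfl | rfl <;>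
      simp

theorem natCast_fin_injective : Function.Injective fun i : Fin n => ((i : ℕ) : ZMod n) := by
  intro i j h
  have h1 := (ZMod.natCast_eq_natCast_iff' _ _ _).mp h
  rw [Nat.mod_eq_of_lt i.2, Nat.mod_eq_of_lt j.2] at h1
  exact Fin.ext h1

variable [NeZero n]

/-- The two-dimensional representation of `D_n` with `σ ↦ diag(ω^j, ω^{-j})`. -/
noncomputable def planeRep (j : ZMod n) : DihedralGroup n →* Matrix (Fin 2) (Fin 2) ℂ where
  toFun
    | r a => !![ZMod.stdAddChar (j * a), 0; 0, ZMod.stdAddChar (-(j * a))]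
    | sr a => !![0, ZMod.stdAddChar (-(j * a)); ZMod.stdAddChar (j * a), 0]
  map_one' := by
    rw [one_def]
    simp [Matrix.one_fin_two]
  map_mul' g h := by
    rcases g with a | a <;> rcases h with b | b <;>
      simp only [r_mul_r, r_mul_sr, sr_mul_r, sr_mul_sr, Matrix.mul_fin_two,
        ← AddChar.map_add_eq_mul, mul_zero, zero_mul, add_zero, zero_add] <;> ring_nf

/-- Since the standard character is injective, comparisons of powers of `ω` become congruences
modulo `n`. -/
theorem omega_zpow (k : ℤ) : omega n ^ k = ZMod.stdAddChar (k : ZMod n) := by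
  rw [ZMod.stdAddChar_coe, omega, ← Complex.exp_int_mul]
  congr 1
  ring

theorem stdAddChar_eq_iff {a b : ZMod n} :
    ZMod.stdAddChar a = ZMod.stdAddChar b ↔ a = b := ZMod.injective_stdAddChar.eq_iff

theorem planeRep_sigma (j : ℕ) : planeRep (j : ZMod n) (sigma n) =
    !![omega n ^ (j : ℤ), 0; 0, omega n ^ (-(j : ℤ))] := by
  rw [omega_zpow, omega_zpow]
  simp [planeRep, sigma]

theorem planeRep_tau (j : ZMod n) : planeRep j (tau n) = !![0, 1; 1, 0] := by
  simp [planeRep, tau]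

theorem closure_sigma_tau : Submonoid.closure {sigma n, tau n} = ⊤ := by
  rw [eq_top_iff]
  rintro g -
  have hs : sigma n ∈ Submonoid.closure {sigma n, tau n} := Submonoid.subset_closure (by simp)
  have ht : tau n ∈ Submonoid.closure {sigma n, tau n} := Submonoid.subset_closure (by simp)
  rcases g with a | a
  · rw [← ZMod.natCast_zmod_val a, ← sigma_pow]
    exact pow_mem hs _
  · rw [← neg_neg a, ← ZMod.natCast_zmod_val (-a), ← sigma_pow_mul_tau]
    exact mul_mem (pow_mem hs _) ht

theorem exists_fin_cast_eq (a : ZMod n) : ∃ i : Fin n, ((i : ℕ) : ZMod n) = a :=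
  ⟨⟨a.val, ZMod.val_lt a⟩, ZMod.natCast_zmod_val a⟩

namespace IrrepIdx

theorem diagonal_eq_sum_single {G : Type*} [DecidableEq G] {d : ℕ} (x : Fin d → G) (g : G) :
    (Matrix.diagonal fun i => if g = x i then (1 : ℂ) else 0) =
      ∑ i : Fin d, if g = x i then Matrix.single i i (1 : ℂ) else 0 := by
  ext a b
  rw [Matrix.sum_apply, Finset.sum_eq_single a _ (by simp)]
  · by_cases hab : a = b
    · subst hab
      split_ifs with h <;> simp [h]
    · rw [Matrix.diagonal_apply_ne _ hab]
      split_ifs with h <;> simp [hab]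
  · intro l _ hl
    split_ifs with h <;> simp [hl]

theorem diagonal_pair_eq {G : Type*} [DecidableEq G] {x y : G} (hxy : x ≠ y) (g : G) :
    (Matrix.diagonal fun i => if g = ![x, y] i then (1 : ℂ) else 0) =
      if g = x then !![1, 0; 0, 0] else if g = y then !![0, 0; 0, 1] else 0 := by
  ext a b
  by_cases ha : g = x
  · subst ha
    fin_cases a <;> fin_cases b <;> simp [hxy]
  · by_cases hb : g = y
    · subst hb
      fin_cases a <;> fin_cases b <;> simp [hxy.symm]
    · fin_cases a <;> fin_cases b <;> simp [ha, hb]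

theorem exists_realizes (hn : Odd n) (i : IrrepIdx n) : ∃ ρ, i.Realizes ρ := by
  cases i with
  | one ε =>
    obtain ⟨φ, h1, h2⟩ := exists_algHom_of_group
      ((algebraMap ℂ (Matrix (Fin 1) (Fin 1) ℂ)).toMonoidHom.comp (signChar n ε))
    exact ⟨φ, (h1 _).trans (map_one (algebraMap ℂ (Matrix (Fin 1) (Fin 1) ℂ))),
      (h1 _).trans (Algebra.algebraMap_eq_smul_one (A := Matrix (Fin 1) (Fin 1) ℂ)
        ((ε : ℤ) : ℂ)), h2⟩
  | two k =>
    obtain ⟨φ, h1, h2⟩ := exists_algHom_of_group (planeRep ((k.1 : ℕ) : ZMod n))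
    exact ⟨φ, (h1 _).trans (planeRep_sigma _), (h1 _).trans (planeRep_tau _), h2⟩
  | rot k j =>
    have hk := natCast_ne_neg_of_rotIdx hn k
    have hk' : sigma n ^ k.1 ≠ (sigma n ^ k.1)⁻¹ := by
      rw [sigma_pow, inv_r]
      exact fun h => hk (r.inj h)
    obtain ⟨φ, h1, h2⟩ := exists_algHom_of_graded ![sigma n ^ k.1, (sigma n ^ k.1)⁻¹]
      (planeRep ((j : ℕ) : ZMod n)) (by
        intro g a b
        rw [sigma_pow, inv_r]
        -- Rotations are diagonal and fix both degrees `σ^{±k}`; reflections are antidiagonal and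
        -- exchange them.
        rcases g with c | c <;> fin_cases a <;> fin_cases b <;> simp [planeRep])
    exact ⟨φ, (h1 _).trans (planeRep_sigma _), (h1 _).trans (planeRep_tau _),
      fun g => (h2 g).trans (diagonal_pair_eq hk' g)⟩
  | refl ε =>
    have hx : Function.Injective fun i : Fin n => (sr (-((i : ℕ) : ZMod n)) : DihedralGroup n) :=
      fun a b h => natCast_fin_injective (neg_injective (sr.inj h))
    -- Basis vector `i`, counted from `0`, has degree `σ^i τ`. Conjugation by `σ` sends `i` to `i +
    -- 2` and conjugation by `τ` sends `i` to `-i`, which gives `A` and `B`; the sign comes from the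
    -- character.
    obtain ⟨φ, h1, h2⟩ := exists_algHom_of_graded (fun i : Fin n => sr (-((i : ℕ) : ZMod n)))
      (monomialRep (fun i : Fin n => sr (-((i : ℕ) : ZMod n))) hx (by
        intro g i
        rcases g with a | a
        · obtain ⟨l, hl⟩ := exists_fin_cast_eq (-(-((i : ℕ) : ZMod n) - a + -a))
          exact ⟨l, by simp [hl, sub_eq_add_neg]⟩
        · obtain ⟨l, hl⟩ := exists_fin_cast_eq (-(a - (-((i : ℕ) : ZMod n) - a)))
          exact ⟨l, by simp [hl]⟩) (signChar n ε))
      (by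
        intro g i j hij
        exact if_neg hij)
    refine ⟨φ, (h1 _).trans ?_, (h1 _).trans ?_, fun g => (h2 g).trans ?_⟩
    · ext i j
      rw [monomialRep_apply]
      change _ = if (i : ℕ) + 1 ≡ ((j : ℕ) + 1) + 2 [MOD n] then (1 : ℂ) else 0
      refine if_congr ?_ rfl rfl
      rw [← ZMod.natCast_eq_natCast_iff, sigma, r_mul_sr, inv_r, sr_mul_r, sr.injEq]
      push_cast
      constructor <;> intro h <;> linear_combination -h
    · ext i j
      rw [monomialRep_apply]
      change _ = (ε : ℂ) * if ((i : ℕ) + 1) + ((j : ℕ) + 1) ≡ 2 [MOD n] then (1 : ℂ) else 0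
      rw [mul_ite, mul_one, mul_zero]
      refine if_congr ?_ rfl rfl
      rw [← ZMod.natCast_eq_natCast_iff, tau, sr_mul_sr, inv_sr, r_mul_sr, sr.injEq]
      push_cast
      constructor <;> intro h <;> linear_combination -h
    · rw [diagonal_eq_sum_single]
      simp only [← sigma_pow_mul_tau]
      rfl

theorem Realizes.unique {i : IrrepIdx n} {ρ ρ'} (h : i.Realizes ρ) (h' : i.Realizes ρ') :
    ρ = ρ' := by
  refine algHom_ext_of_closure closure_sigma_tau ?_ fun g => (h.2.2 g).trans (h'.2.2 g).symm
  rintro g (rfl | rfl)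
  · exact h.1.trans h'.1.symm
  · exact h.2.1.trans h'.2.1.symm

end IrrepIdx
end DihedralOdd

/-! ### Fibres and irreducibility of the listed representations. -/

theorem Representation.isIrreducible_of_diagonal_of_swap {H : Type*} [Monoid H]
    (β : Representation ℂ H (Fin 2 → ℂ)) {s t : H} {a b : ℂ} (hab : a ≠ b)
    (hs : β s = Matrix.toLin' !![a, 0; 0, b]) (ht : β t = Matrix.toLin' !![0, 1; 1, 0]) :
    β.IsIrreducible := by
  have hs' : ∀ v : Fin 2 → ℂ, β s v = ![a * v 0, b * v 1] := by
    intro v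
    rw [hs]
    ext i
    fin_cases i <;> simp [Matrix.mulVec, dotProduct, Fin.sum_univ_two]
  have ht' : ∀ v : Fin 2 → ℂ, β t v = ![v 1, v 0] := by
    intro v
    rw [ht]
    ext i
    fin_cases i <;> simp [Matrix.mulVec, dotProduct, Fin.sum_univ_two]
  have hne : Nontrivial (Subrepresentation β) := by
    refine ⟨⊥, ⊤, fun h0 => ?_⟩
    exact bot_ne_top (α := Submodule ℂ (Fin 2 → ℂ))
      (congrArg Subrepresentation.toSubmodule h0)
  refine ⟨fun U => or_iff_not_imp_left.mpr fun hU => ?_⟩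
  have hU' : U.toSubmodule ≠ ⊥ := fun h0 => hU (Subrepresentation.toSubmodule_injective h0)
  obtain ⟨v, hvU, hv⟩ := (Submodule.ne_bot_iff _).mp hU'
  -- Because `a ≠ b`, the operator `(a - b)⁻¹ (β s - b)` is the projection onto the first axis.
  have h0 : (![v 0, 0] : Fin 2 → ℂ) ∈ U.toSubmodule := by
    have h1 := U.toSubmodule.smul_mem (a - b)⁻¹ (U.toSubmodule.sub_mem
      (U.apply_mem_toSubmodule s hvU) (U.toSubmodule.smul_mem b hvU))
    convert h1 using 1
    rw [hs']
    have := sub_ne_zero.mpr hab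
    ext i
    fin_cases i
    · change v 0 = (a - b)⁻¹ * (a * v 0 - b * v 0)
      field_simp
    · change 0 = (a - b)⁻¹ * (b * v 1 - b * v 1)
      ring
  have h1 : (![0, v 1] : Fin 2 → ℂ) ∈ U.toSubmodule := by
    have h1 := U.toSubmodule.sub_mem hvU h0
    convert h1 using 1
    ext i
    fin_cases i <;> simp
  -- One of the two axis components of `v` is nonzero; if it is the second, the swap moves it to the
  -- first axis.
  have h2 : ∃ c : ℂ, c ≠ 0 ∧ (![c, 0] : Fin 2 → ℂ) ∈ U.toSubmodule := by
    by_cases hv0 : v 0 = 0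
    · refine ⟨v 1, fun hv1 => hv ?_, ?_⟩
      · ext i
        fin_cases i
        · exact hv0
        · exact hv1
      · have h2 := U.apply_mem_toSubmodule t h1
        rw [ht'] at h2
        simpa using h2
    · exact ⟨v 0, hv0, h0⟩
  obtain ⟨c, hc, hcU⟩ := h2
  have hcU' := U.apply_mem_toSubmodule t hcU
  rw [ht'] at hcU'
  apply Subrepresentation.toSubmodule_injective
  refine eq_top_iff.mpr fun x _ => ?_
  have h3 := U.toSubmodule.add_mem (U.toSubmodule.smul_mem (x 0 / c) hcU)
    (U.toSubmodule.smul_mem (x 1 / c) hcU')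
  convert h3 using 1
  ext i
  fin_cases i <;> simp [hc]

namespace DihedralOdd
open DihedralGroup QuantumDouble
variable {n : ℕ} [NeZero n]

theorem alpha_conj_of_mem_conjugatesOf (hn : Odd n) (c : ClassIdx n) :
    ∀ s ∈ conjugatesOf c.rep, s = c.alpha s * c.rep * (c.alpha s)⁻¹ := by
  rw [ClassIdx.conjugatesOf_rep hn]
  exact ClassIdx.eq_alpha_conj hn c

theorem omega_zpow_ne_neg (hn : Odd n) (k : RotIdx n) :
    omega n ^ (k.1 : ℤ) ≠ omega n ^ (-(k.1 : ℤ)) := by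
  rw [omega_zpow, omega_zpow, Ne, stdAddChar_eq_iff]
  push_cast
  exact natCast_ne_neg_of_rotIdx hn k

namespace IrrepIdx

theorem sum_single_tau : (∑ i : Fin n, if tau n = sigma n ^ (i : ℕ) * tau n then
    Matrix.single i i (1 : ℂ) else 0) = Matrix.single 0 0 1 := by
  refine (Finset.sum_eq_single (0 : Fin n) ?_ (by simp)).trans (if_pos (by simp))
  intro l _ hl
  refine if_neg fun h0 => hl ?_
  rw [sigma_pow_mul_tau] at h0
  refine natCast_fin_injective ?_
  have h1 := sr.inj h0
  simpa using h1.symm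

/-- For the class of the identity the fibre is the whole space. In the other cases the idempotent of
the representative is an elementary matrix, so the fibre is a line, and its character is read off
from a diagonal entry. -/
theorem Realizes.exists_isInducedFrom (hn : Odd n) {i : IrrepIdx n} {ρ} (h : i.Realizes ρ) :
    ∃ β : Representation ℂ (Subgroup.centralizer {i.cls.rep}) (Fin i.fibreDim → ℂ),
      i.IsFibre β ∧ β.IsIrreducible ∧ IsInducedFrom ρ i.cls.rep i.cls.alpha β := by
  obtain ⟨hσ, hτ, hd⟩ := h
  cases i with
  | one ε =>
    refine ⟨restrictGroup (d := 1) ρ, fun z => ⟨fun hz => ?_, fun hz => ?_⟩,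
      Representation.isIrreducible_of_finrank_eq_one _ (Module.finrank_fin_fun ℂ),
      isInducedFrom_restrictGroup (d := 1) ((hd 1).trans (if_pos rfl))⟩
    · refine (restrictGroup_apply (d := 1) ρ z).trans ?_
      rw [hz]
      exact (congrArg Matrix.toLin' hσ).trans Matrix.toLin'_one
    · refine (restrictGroup_apply (d := 1) ρ z).trans ?_
      rw [hz]
      refine (congrArg Matrix.toLin' hτ).trans ?_
      exact (map_smul Matrix.toLin' _ _).trans (congrArg _ Matrix.toLin'_one)
  | two k =>
    have hz : ∀ (z : Subgroup.centralizer {(1 : DihedralGroup n)}),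
      ((z : DihedralGroup n) = sigma n → restrictGroup (d := 2) ρ z =
        Matrix.toLin' !![omega n ^ (k.1 : ℤ), 0; 0, omega n ^ (-(k.1 : ℤ))]) ∧
      ((z : DihedralGroup n) = tau n →
        restrictGroup (d := 2) ρ z = Matrix.toLin' !![0, 1; 1, 0]) := by
      refine fun z => ⟨fun hz => ?_, fun hz => ?_⟩
      · refine (restrictGroup_apply (d := 2) ρ z).trans ?_
        rw [hz]
        exact congrArg Matrix.toLin' hσ
      · refine (restrictGroup_apply (d := 2) ρ z).trans ?_
        rw [hz]
        exact congrArg Matrix.toLin' hτ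
    have hmem : ∀ g, g ∈ Subgroup.centralizer {(1 : DihedralGroup n)} := fun g =>
      Subgroup.mem_centralizer_singleton_iff.mpr (by simp)
    exact ⟨restrictGroup (d := 2) ρ, hz,
      Representation.isIrreducible_of_diagonal_of_swap _ (omega_zpow_ne_neg hn k)
        ((hz ⟨_, hmem (sigma n)⟩).1 rfl) ((hz ⟨_, hmem (tau n)⟩).2 rfl),
      isInducedFrom_restrictGroup (d := 2) ((hd 1).trans (if_pos rfl))⟩
  | rot k j =>
    obtain ⟨β, hβ, hind⟩ := exists_isInducedFrom_character (d := 2) (ρ := ρ)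
      (alpha_conj_of_mem_conjugatesOf hn (.rot k)) 0 (by
        refine (hd _).trans ((if_pos rfl).trans ?_)
        ext a b
        fin_cases a <;> fin_cases b <;> simp) (ClassIdx.card_conjugatesOf_rot hn k)
    refine ⟨β, fun z hz => (hβ z).trans ?_,
      Representation.isIrreducible_of_finrank_eq_one _ (Module.finrank_fin_fun ℂ), hind⟩
    rw [hz]
    refine congrArg (· • (1 : Module.End ℂ (Fin 1 → ℂ))) ?_
    refine (congrFun (congrFun hσ (0 : Fin 2)) (0 : Fin 2)).trans ?_
    exact zpow_natCast _ _
  | refl ε =>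
    obtain ⟨β, hβ, hind⟩ := exists_isInducedFrom_character (d := n) (ρ := ρ)
      (alpha_conj_of_mem_conjugatesOf hn .refl) 0 ((hd _).trans sum_single_tau)
      (ClassIdx.card_conjugatesOf_refl hn)
    refine ⟨β, fun z hz => (hβ z).trans ?_,
      Representation.isIrreducible_of_finrank_eq_one _ (Module.finrank_fin_fun ℂ), hind⟩
    rw [hz]
    refine congrArg (· • (1 : Module.End ℂ (Fin 1 → ℂ))) ?_
    refine (congrFun (congrFun hτ (0 : Fin n)) (0 : Fin n)).trans ?_
    change (ε : ℂ) * (if _ then _ else _) = _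
    rw [if_pos (by simp [Nat.ModEq]), mul_one]

theorem Realizes.isSimpleModule (hn : Odd n) {i : IrrepIdx n} {ρ} (h : i.Realizes ρ) :
    IsSimpleModule (QuantumDouble (DihedralGroup n)) (RepSpace ρ) := by
  obtain ⟨β, -, hβ, hind⟩ := h.exists_isInducedFrom hn
  exact hind.isSimpleModule (alpha_conj_of_mem_conjugatesOf hn _) (ClassIdx.alpha_rep _) hβ

end IrrepIdx
end DihedralOdd

/-! ### The listed representations are pairwise non-isomorphic. -/

theorem RepSpace.map_eq_zero_of_linearEquiv {A : Type u} [Ring A] [Algebra ℂ A] {d d' : ℕ}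
    {ρ : A →ₐ[ℂ] Matrix (Fin d) (Fin d) ℂ} {ρ' : A →ₐ[ℂ] Matrix (Fin d') (Fin d') ℂ}
    (e : RepSpace ρ ≃ₗ[A] RepSpace ρ') {a : A} (ha : ρ a = 0) : ρ' a = 0 := by
  apply Matrix.ext_of_mulVec_single
  intro i
  rw [Matrix.zero_mulVec]
  have h1 : ∀ w : RepSpace ρ', a • w = 0 := by
    intro w
    obtain ⟨v, rfl⟩ := e.surjective w
    have h2 : a • v = 0 := by
      change ρ a *ᵥ (show Fin d → ℂ from v) = 0
      rw [ha, Matrix.zero_mulVec]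
    rw [← map_smul, h2, map_zero]
  exact h1 (Pi.single i 1 : Fin d' → ℂ)

namespace DihedralOdd
open DihedralGroup QuantumDouble
variable {n : ℕ} [NeZero n]

theorem intCast_units_injective {ε ε' : ℤˣ} (h : ((ε : ℤ) : ℂ) = ((ε' : ℤ) : ℂ)) : ε = ε' :=
  Units.ext (Int.cast_injective h)

namespace IrrepIdx

theorem dualMat_rep_ne_zero (i : IrrepIdx n) : i.dualMat i.cls.rep ≠ 0 := by
  cases i with
  | one ε =>
    intro h
    have h1 : (1 : Matrix (Fin 1) (Fin 1) ℂ) = 0 := (if_pos rfl).symm.trans h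
    exact one_ne_zero h1
  | two k =>
    intro h
    have h1 : (1 : Matrix (Fin 2) (Fin 2) ℂ) = 0 := (if_pos rfl).symm.trans h
    exact one_ne_zero h1
  | rot k j =>
    intro h
    have h1 : (!![1, 0; 0, 0] : Matrix (Fin 2) (Fin 2) ℂ) = 0 := (if_pos rfl).symm.trans h
    simpa using congrFun (congrFun h1 0) 0
  | refl ε =>
    intro h
    have h1 : (Matrix.single 0 0 1 : Matrix (Fin n) (Fin n) ℂ) = 0 := sum_single_tau.symm.trans h
    simpa using congrFun (congrFun h1 0) 0

omit [NeZero n] in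
theorem mem_elements_of_dualMat_ne_zero (i : IrrepIdx n) {g : DihedralGroup n}
    (h : i.dualMat g ≠ 0) : g ∈ i.cls.elements := by
  contrapose! h
  cases i with
  | one ε => exact if_neg h
  | two k => exact if_neg h
  | rot k j =>
    have h1 : g ≠ sigma n ^ k.1 := fun h0 => h (Or.inl h0)
    have h2 : g ≠ (sigma n ^ k.1)⁻¹ := fun h0 => h (Or.inr h0)
    exact (if_neg h1).trans (if_neg h2)
  | refl ε =>
    exact Finset.sum_eq_zero fun l _ => if_neg fun h0 => h ⟨l, l.2, h0⟩

/-- The class is the support of the grading, which the annihilator determines: `h^*` acts as zero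
off the class and not as zero at its representative. -/
theorem cls_eq_of_map_eq_zero (hn : Odd n) {i j : IrrepIdx n} {ρ ρ'} (hi : i.Realizes ρ)
    (hj : j.Realizes ρ') (hK : ∀ a, ρ' a = 0 → ρ a = 0) : i.cls = j.cls := by
  have h1 : i.cls.rep ∈ j.cls.elements := by
    refine mem_elements_of_dualMat_ne_zero j fun h0 => dualMat_rep_ne_zero i ?_
    rw [← hi.2.2]
    exact hK _ ((hj.2.2 _).trans h0)
  rw [← ClassIdx.conjugatesOf_rep hn] at h1
  exact ((ClassIdx.bijective_mk_rep hn).1 (ConjClasses.mk_eq_mk_iff_isConj.mpr h1)).symm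

theorem eq_of_linearEquiv (hn : Odd n) {i j : IrrepIdx n} {ρ ρ'} (hi : i.Realizes ρ)
    (hj : j.Realizes ρ') (e : RepSpace ρ ≃ₗ[QuantumDouble (DihedralGroup n)] RepSpace ρ') :
    i = j := by
  have K : ∀ a, ρ a = 0 → ρ' a = 0 := fun a => RepSpace.map_eq_zero_of_linearEquiv e
  have K' : ∀ a, ρ' a = 0 → ρ a = 0 := fun a => RepSpace.map_eq_zero_of_linearEquiv e.symm
  have hc := cls_eq_of_map_eq_zero hn hi hj K'
  obtain ⟨hσ, hτ, hd⟩ := hi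
  obtain ⟨hσ', hτ', hd'⟩ := hj
  have one_two : ∀ (k : RotIdx n) (φ : QuantumDouble (DihedralGroup n) →ₐ[ℂ]
      Matrix (Fin 1) (Fin 1) ℂ) (ψ : QuantumDouble (DihedralGroup n) →ₐ[ℂ]
      Matrix (Fin 2) (Fin 2) ℂ), φ (grp (sigma n)) = 1 →
      ψ (grp (sigma n)) = !![omega n ^ (k.1 : ℤ), 0; 0, omega n ^ (-(k.1 : ℤ))] →
      (∀ a, φ a = 0 → ψ a = 0) → False := by
    intro k φ ψ h1 h2 hK
    -- The separating element is `σ - 1`: it kills the one-dimensional modules, but not a plane with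
    -- eigenvalue `ω^k ≠ 1`.
    have h3 := congrFun (congrFun (hK (grp (sigma n) - 1) (by simp [h1])) 0) 0
    rw [map_sub, map_one, h2] at h3
    have h4 : omega n ^ (k.1 : ℤ) = omega n ^ (0 : ℤ) := by
      simpa [sub_eq_zero] using h3
    rw [omega_zpow, omega_zpow, stdAddChar_eq_iff] at h4
    exact natCast_ne_zero_of_rotIdx k (by exact_mod_cast h4)
  cases i with
  | one ε =>
    cases j with
    | one ε' =>
      have aux : ∀ φ ψ : QuantumDouble (DihedralGroup n) →ₐ[ℂ] Matrix (Fin 1) (Fin 1) ℂ,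
          φ (grp (tau n)) = ((ε : ℤ) : ℂ) • 1 → ψ (grp (tau n)) = ((ε' : ℤ) : ℂ) • 1 →
          (∀ a, φ a = 0 → ψ a = 0) → ε = ε' := by
        intro φ ψ h1 h2 hK
        have h3 := congrFun (congrFun
          (hK (grp (tau n) - ((ε : ℤ) : ℂ) • 1)
            (by rw [map_sub, map_smul, map_one, h1, sub_self])) 0) 0
        rw [map_sub, map_smul, map_one, h2] at h3
        refine (intCast_units_injective ?_).symm
        simpa [sub_eq_zero] using h3
      rw [aux ρ ρ' hτ hτ' K]
    | two k => exact (one_two k ρ ρ' hσ hσ' K).elim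
    | rot k j => cases hc
    | refl ε' => cases hc
  | two k =>
    cases j with
    | one ε' => exact (one_two k ρ' ρ hσ' hσ K').elim
    | two l =>
      have aux : ∀ φ ψ : QuantumDouble (DihedralGroup n) →ₐ[ℂ] Matrix (Fin 2) (Fin 2) ℂ,
          φ (grp (sigma n)) = !![omega n ^ (k.1 : ℤ), 0; 0, omega n ^ (-(k.1 : ℤ))] →
          ψ (grp (sigma n)) = !![omega n ^ (l.1 : ℤ), 0; 0, omega n ^ (-(l.1 : ℤ))] →
          (∀ a, φ a = 0 → ψ a = 0) → k = l := by
        intro φ ψ h1 h2 hK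
        -- The characteristic polynomial of `σ` on the plane for `k` must kill the plane for `l`, so
        -- `ω^l` is one of `ω^{±k}`.
        have h3 := congrFun (congrFun (hK ((grp (sigma n) - (omega n ^ (k.1 : ℤ)) • 1) *
          (grp (sigma n) - (omega n ^ (-(k.1 : ℤ))) • 1)) (by
            rw [map_mul, map_sub, map_sub, map_smul, map_smul, map_one, h1, Matrix.one_fin_two]
            ext a b
            fin_cases a <;> fin_cases b <;> simp)) 0) 0
        rw [map_mul, map_sub, map_sub, map_smul, map_smul, map_one, h2, Matrix.one_fin_two] at h3
        have h4 : (omega n ^ (l.1 : ℤ) - omega n ^ (k.1 : ℤ)) *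
            (omega n ^ (l.1 : ℤ) - omega n ^ (-(k.1 : ℤ))) = 0 := by
          simpa only [Matrix.smul_of, Matrix.smul_cons, Matrix.sub_apply, Matrix.mul_apply,
            Fin.sum_univ_two, Matrix.of_apply, Matrix.cons_val, smul_eq_mul, mul_one, mul_zero,
            sub_zero, add_zero, sub_self, Matrix.zero_apply] using h3
        rw [mul_eq_zero, sub_eq_zero, sub_eq_zero, omega_zpow, omega_zpow, omega_zpow,
          stdAddChar_eq_iff, stdAddChar_eq_iff] at h4
        push_cast at h4
        exact h4.elim (fun h => (eq_of_rotIdx_cast h).symm)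
          fun h => absurd h ne_neg_of_rotIdx_cast
      rw [aux ρ ρ' hσ hσ' K]
    | rot l j => cases hc
    | refl ε' => cases hc
  | rot k a =>
    cases j with
    | one ε' => cases hc
    | two l => cases hc
    | rot l b =>
      cases hc
      have aux : ∀ φ ψ : QuantumDouble (DihedralGroup n) →ₐ[ℂ] Matrix (Fin 2) (Fin 2) ℂ,
          φ (grp (sigma n)) =
            !![omega n ^ ((a : ℕ) : ℤ), 0; 0, omega n ^ (-((a : ℕ) : ℤ))] →
          ψ (grp (sigma n)) =
            !![omega n ^ ((b : ℕ) : ℤ), 0; 0, omega n ^ (-((b : ℕ) : ℤ))] →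
          φ (dual (sigma n ^ k.1)) = !![1, 0; 0, 0] →
          ψ (dual (sigma n ^ k.1)) = !![1, 0; 0, 0] →
          (∀ a, φ a = 0 → ψ a = 0) → a = b := by
        intro φ ψ h1 h2 h1' h2' hK
        -- Multiplying by `(σ^k)^*` restricts to the fibre, where `σ` acts by the single scalar
        -- `ω^a`.
        have h3 := congrFun (congrFun (hK ((grp (sigma n) - (omega n ^ ((a : ℕ) : ℤ)) • 1) *
          dual (sigma n ^ k.1)) (by
            rw [map_mul, map_sub, map_smul, map_one, h1, h1', Matrix.one_fin_two]
            ext i j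
            fin_cases i <;> fin_cases j <;> simp)) 0) 0
        rw [map_mul, map_sub, map_smul, map_one, h2, h2', Matrix.one_fin_two] at h3
        have h4 : omega n ^ ((b : ℕ) : ℤ) - omega n ^ ((a : ℕ) : ℤ) = 0 := by
          simpa only [Matrix.smul_of, Matrix.smul_cons, Matrix.sub_apply, Matrix.mul_apply,
            Fin.sum_univ_two, Matrix.of_apply, Matrix.cons_val, smul_eq_mul, mul_one, mul_zero,
            sub_zero, add_zero, sub_self, Matrix.zero_apply] using h3
        rw [sub_eq_zero, omega_zpow, omega_zpow, stdAddChar_eq_iff] at h4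
        push_cast at h4
        exact (natCast_fin_injective h4).symm
      rw [aux ρ ρ' hσ hσ' ((hd _).trans (if_pos rfl)) ((hd' _).trans (if_pos rfl)) K]
    | refl ε' => cases hc
  | refl ε =>
    cases j with
    | one ε' => cases hc
    | two l => cases hc
    | rot l j' => cases hc
    | refl ε' =>
      let B : Matrix (Fin n) (Fin n) ℂ := Matrix.of fun i j : Fin n =>
        if ((i : ℕ) + 1) + ((j : ℕ) + 1) ≡ 2 [MOD n] then (1 : ℂ) else 0
      have hcol : ∀ i : Fin n, B i 0 = if i = 0 then (1 : ℂ) else 0 := by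
        intro i
        refine if_congr ?_ rfl rfl
        rw [← ZMod.natCast_eq_natCast_iff, ← natCast_fin_injective.eq_iff]
        push_cast
        rw [Fin.val_zero, Nat.cast_zero]
        constructor <;> intro h <;> linear_combination h
      have aux : ∀ φ ψ : QuantumDouble (DihedralGroup n) →ₐ[ℂ] Matrix (Fin n) (Fin n) ℂ,
          φ (grp (tau n)) = ((ε : ℤ) : ℂ) • B → ψ (grp (tau n)) = ((ε' : ℤ) : ℂ) • B →
          φ (dual (tau n)) = Matrix.single 0 0 1 → ψ (dual (tau n)) = Matrix.single 0 0 1 →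
          (∀ a, φ a = 0 → ψ a = 0) → ε = ε' := by
        intro φ ψ h1 h2 h1' h2' hK
        -- On the fibre of degree `τ`, spanned by the first basis vector, `τ` acts by its sign;
        -- hence `(τ - ε) τ^*` detects `ε`.
        have h3 := congrFun (congrFun (hK ((grp (tau n) - ((ε : ℤ) : ℂ) • 1) * dual (tau n)) (by
            rw [map_mul, map_sub, map_smul, map_one, h1, h1']
            ext a b
            by_cases hb : b = 0
            · subst hb
              rw [Matrix.mul_single_apply_same, Matrix.sub_apply, Matrix.smul_apply, hcol]
              by_cases ha : a = 0 <;> simp [ha]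
            · simp [hb])) 0) 0
        rw [map_mul, map_sub, map_smul, map_one, h2, h2', Matrix.mul_single_apply_same,
          Matrix.sub_apply, Matrix.smul_apply, hcol] at h3
        refine (intCast_units_injective ?_).symm
        simpa [sub_eq_zero] using h3
      rw [aux ρ ρ' hτ hτ' ((hd _).trans sum_single_tau)
        ((hd' _).trans sum_single_tau) K]

end IrrepIdx
end DihedralOdd

-- Every simple module is isomorphic to a listed one.

universe v

namespace DihedralOdd
open DihedralGroup QuantumDouble
variable {n : ℕ} [NeZero n]

omit [NeZero n] in
theorem r_mul_tau (a : ZMod n) : r a * tau n = tau n * r (-a) := by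
  simp [tau]

section Module

variable {V : Type v} [AddCommGroup V] [Module (QuantumDouble (DihedralGroup n)) V]

theorem grp_tau_smul_grp_tau_smul (u : V) : (grp (tau n) : QuantumDouble (DihedralGroup n)) •
    (grp (tau n) : QuantumDouble (DihedralGroup n)) • u = u := by
  rw [← mul_smul, grp_mul_grp, tau, sr_mul_self, grp_one, one_smul]

theorem grp_r_smul_grp_tau_smul (a : ZMod n) (u : V) :
    (grp (r a) : QuantumDouble (DihedralGroup n)) •
      (grp (tau n) : QuantumDouble (DihedralGroup n)) • u =
    (grp (tau n) : QuantumDouble (DihedralGroup n)) •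
      (grp (r (-a)) : QuantumDouble (DihedralGroup n)) • u := by
  rw [← mul_smul, ← mul_smul, grp_mul_grp, grp_mul_grp, r_mul_tau]

/-- Since the `h^*` sum to `1`, some homogeneous component of a nonzero vector is nonzero; `α_h⁻¹`
moves it to the degree of the representative. -/
theorem exists_dual_rep_smul_eq (hn : Odd n) [Nontrivial V] : ∃ (c : ClassIdx n) (u : V), u ≠ 0 ∧
    (dual c.rep : QuantumDouble (DihedralGroup n)) • u = u := by
  obtain ⟨v, hv⟩ := exists_ne (0 : V)
  obtain ⟨h, hh⟩ : ∃ h : DihedralGroup n,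
      (dual h : QuantumDouble (DihedralGroup n)) • v ≠ 0 := by
    by_contra! h0
    apply hv
    rw [← one_smul (QuantumDouble (DihedralGroup n)) v, ← sum_dual, Finset.sum_smul]
    exact Finset.sum_eq_zero fun h _ => h0 h
  obtain ⟨c, hc⟩ := ClassIdx.exists_mem_elements hn h
  have hconj := ClassIdx.eq_alpha_conj hn c h hc
  refine ⟨c, (grp (c.alpha h)⁻¹ : QuantumDouble (DihedralGroup n)) •
    (dual h : QuantumDouble (DihedralGroup n)) • v, fun h0 => hh ?_, ?_⟩
  · have h1 := congrArg (fun x => (grp (c.alpha h) : QuantumDouble (DihedralGroup n)) • x) h0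
    simpa only [← mul_smul, ← mul_assoc, grp_mul_grp, mul_inv_cancel, grp_one, one_mul,
      smul_zero] using h1
  · rw [← mul_smul, ← mul_smul, mul_assoc, dual_mul_grp_mul_dual, if_pos, mul_smul]
    rw [inv_inv, eq_comm, mul_assoc, inv_mul_eq_iff_eq_mul]
    exact eq_mul_inv_iff_mul_eq.mp hconj

variable [Module ℂ V]

theorem equivariant_of_sigma_tau {W : Type} [AddCommGroup W] [Module ℂ W]
    (β : Representation ℂ (Subgroup.centralizer {(1 : DihedralGroup n)}) W) (f : W →ₗ[ℂ] V)
    (hσ : ∀ z : Subgroup.centralizer {(1 : DihedralGroup n)}, (z : DihedralGroup n) = sigma n →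
      ∀ w, grp (sigma n) • f w = f (β z w))
    (hτ : ∀ z : Subgroup.centralizer {(1 : DihedralGroup n)}, (z : DihedralGroup n) = tau n →
      ∀ w, grp (tau n) • f w = f (β z w))
    (z : Subgroup.centralizer {(1 : DihedralGroup n)}) (w : W) :
    grp (z : DihedralGroup n) • f w = f (β z w) := by
  have hmem : ∀ g, g ∈ Subgroup.centralizer {(1 : DihedralGroup n)} := fun g =>
    Subgroup.mem_centralizer_singleton_iff.mpr (by simp)
  have key : ∀ g ∈ Submonoid.closure {sigma n, tau n}, ∀ w,
      grp g • f w = f (β ⟨g, hmem g⟩ w) := by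
    intro g hg
    induction hg using Submonoid.closure_induction with
    | mem g hg =>
      rcases hg with rfl | rfl
      · exact hσ _ rfl
      · exact hτ _ rfl
    | one =>
      intro w
      rw [grp_one, one_smul, show (⟨1, hmem 1⟩ : Subgroup.centralizer {(1 : DihedralGroup n)}) = 1
        from rfl, map_one, Module.End.one_apply]
    | mul g h _ _ hg hh =>
      intro w
      rw [← grp_mul_grp, mul_smul, hh, hg, show (⟨g * h, hmem _⟩ :
        Subgroup.centralizer {(1 : DihedralGroup n)}) = ⟨g, hmem g⟩ * ⟨h, hmem h⟩ from rfl,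
        map_mul, Module.End.mul_apply]
  exact key z (closure_sigma_tau (n := n) ▸ Submonoid.mem_top _) w

variable [IsScalarTower ℂ (QuantumDouble (DihedralGroup n)) V]

/-- A nonzero vector has a nonzero component in some eigenspace of the rotations. -/
theorem exists_rotation_eigenvector {u : V} (hu : u ≠ 0) : ∃ (j : ZMod n) (w : V), w ≠ 0 ∧
    (∀ a : ZMod n, (grp (r a) : QuantumDouble (DihedralGroup n)) • w =
      (ZMod.stdAddChar (j * a) : ℂ) • w) ∧
    ∀ h : DihedralGroup n, (∀ a : ZMod n, (r a)⁻¹ * h * r a = h) →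
      (dual h : QuantumDouble (DihedralGroup n)) • u = u →
      (dual h : QuantumDouble (DihedralGroup n)) • w = w := by
  have : SMulCommClass (QuantumDouble (DihedralGroup n)) ℂ V := IsScalarTower.to_smulCommClass'
  -- These are the unnormalised projections to the eigenspaces of the rotations. By orthogonality of
  -- characters they sum to `n u ≠ 0`, so one of them is nonzero.
  let w : ZMod n → V := fun j => ∑ a : ZMod n, (ZMod.stdAddChar (-(j * a)) : ℂ) •
    (grp (r a) : QuantumDouble (DihedralGroup n)) • u
  have hsum : ∑ j, w j = (n : ℂ) • u := by
    simp only [w]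
    rw [Finset.sum_comm]
    simp only [← Finset.sum_smul]
    have h1 : ∀ a : ZMod n, ∑ j : ZMod n, (ZMod.stdAddChar (-(j * a)) : ℂ) =
        if a = 0 then (n : ℂ) else 0 := by
      intro a
      have h2 := AddChar.sum_mulShift (-a) (ZMod.isPrimitive_stdAddChar n)
      simpa only [mul_neg, neg_eq_zero, ZMod.card, Nat.cast_ite, Nat.cast_zero] using h2
    rw [Finset.sum_eq_single 0 _ (by simp)]
    · rw [h1, if_pos rfl, r_zero, grp_one, one_smul]
    · intro a _ ha
      rw [h1, if_neg ha, zero_smul]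
  obtain ⟨j, hj⟩ : ∃ j, w j ≠ 0 := by
    by_contra! h0
    rw [Finset.sum_eq_zero fun j _ => h0 j] at hsum
    exact (smul_ne_zero (Nat.cast_ne_zero.mpr (NeZero.ne n)) hu) hsum.symm
  refine ⟨j, w j, hj, fun a => ?_, fun h hc hh => ?_⟩
  · simp only [w, Finset.smul_sum]
    refine Fintype.sum_equiv (Equiv.addLeft a) _ _ fun b => ?_
    rw [smul_comm, ← mul_smul, grp_mul_grp, r_mul_r, smul_smul, ← AddChar.map_add_eq_mul,
      Equiv.coe_addLeft]
    congr 2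
    ring
  · simp only [w, Finset.smul_sum]
    refine Finset.sum_congr rfl fun a _ => ?_
    rw [smul_comm, ← mul_smul, dual_mul_grp, hc, mul_smul, hh]

/-- A nonzero vector has a nonzero component in some eigenspace of `τ`. -/
theorem exists_tau_eigenvector {u : V} (hu : u ≠ 0) : ∃ (ε : ℤˣ) (w : V), w ≠ 0 ∧
    w = u + ((ε : ℤ) : ℂ) • (grp (tau n) : QuantumDouble (DihedralGroup n)) • u ∧
    (grp (tau n) : QuantumDouble (DihedralGroup n)) • w = ((ε : ℤ) : ℂ) • w := by
  have : SMulCommClass (QuantumDouble (DihedralGroup n)) ℂ V := IsScalarTower.to_smulCommClass'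
  have heig : ∀ ε : ℤˣ, (grp (tau n) : QuantumDouble (DihedralGroup n)) •
      (u + ((ε : ℤ) : ℂ) • (grp (tau n) : QuantumDouble (DihedralGroup n)) • u) =
      ((ε : ℤ) : ℂ) • (u + ((ε : ℤ) : ℂ) •
        (grp (tau n) : QuantumDouble (DihedralGroup n)) • u) := by
    intro ε
    rw [smul_add, smul_comm, grp_tau_smul_grp_tau_smul, smul_add, smul_smul, ← Int.cast_mul,
      ← Units.val_mul, Int.units_mul_self, Units.val_one, Int.cast_one, one_smul, add_comm]
  by_cases h1 : u + (((1 : ℤˣ) : ℤ) : ℂ) •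
      (grp (tau n) : QuantumDouble (DihedralGroup n)) • u = 0
  -- If `u + τ u = 0`, then `u - τ u = 2 u` is nonzero.
  · refine ⟨-1, _, ?_, rfl, heig _⟩
    simp only [Units.val_one, Int.cast_one, one_smul] at h1
    simp only [Units.val_neg, Units.val_one, Int.cast_neg, Int.cast_one, neg_smul, one_smul]
    rw [← eq_neg_of_add_eq_zero_left h1, ← two_smul ℂ]
    exact smul_ne_zero two_ne_zero hu
  · exact ⟨1, _, h1, rfl, heig _⟩

theorem line_equivariant {Z : Subgroup (DihedralGroup n)} (β : Representation ℂ Z (Fin 1 → ℂ))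
    {f : (Fin 1 → ℂ) →ₗ[ℂ] V} {w : V} (hf : ∀ x, f x = x 0 • w) {z : Z} {c : ℂ} (hβ : β z = c • 1)
    (hw : grp (z : DihedralGroup n) • w = c • w) (y : Fin 1 → ℂ) :
    grp (z : DihedralGroup n) • f y = f (β z y) := by
  have : SMulCommClass (QuantumDouble (DihedralGroup n)) ℂ V := IsScalarTower.to_smulCommClass'
  rw [hβ, LinearMap.smul_apply, Module.End.one_apply, map_smul, hf, smul_comm, hw, smul_comm]

theorem line_smul_eq {f : (Fin 1 → ℂ) →ₗ[ℂ] V} {w : V} (hf : ∀ x, f x = x 0 • w)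
    {a : QuantumDouble (DihedralGroup n)} (hw : a • w = w) (y : Fin 1 → ℂ) : a • f y = f y := by
  have : SMulCommClass (QuantumDouble (DihedralGroup n)) ℂ V := IsScalarTower.to_smulCommClass'
  rw [hf, smul_comm, hw]

theorem plane_smul_eq {f : (Fin 2 → ℂ) →ₗ[ℂ] V} {x x' : V} (hf : ∀ y, f y = y 0 • x + y 1 • x')
    {a : QuantumDouble (DihedralGroup n)} (hx : a • x = x) (hx' : a • x' = x') (y : Fin 2 → ℂ) :
    a • f y = f y := by
  have : SMulCommClass (QuantumDouble (DihedralGroup n)) ℂ V := IsScalarTower.to_smulCommClass'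
  rw [hf, smul_add, smul_comm, smul_comm _ (y 1), hx, hx']

theorem plane_equivariant_sigma {Z : Subgroup (DihedralGroup n)}
    (β : Representation ℂ Z (Fin 2 → ℂ)) {f : (Fin 2 → ℂ) →ₗ[ℂ] V} {x x' : V}
    (hf : ∀ y, f y = y 0 • x + y 1 • x') {z : Z} {c c' : ℂ} {g : DihedralGroup n}
    (hβ : β z = Matrix.toLin' !![c, 0; 0, c'])
    (hx : (grp g : QuantumDouble (DihedralGroup n)) • x = c • x)
    (hx' : (grp g : QuantumDouble (DihedralGroup n)) • x' = c' • x') (y : Fin 2 → ℂ) :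
    (grp g : QuantumDouble (DihedralGroup n)) • f y = f (β z y) := by
  have : SMulCommClass (QuantumDouble (DihedralGroup n)) ℂ V := IsScalarTower.to_smulCommClass'
  rw [hf, smul_add, smul_comm, smul_comm _ (y 1), hx, hx', hβ, hf]
  simp [Matrix.mulVec, dotProduct, Fin.sum_univ_two, smul_smul, mul_comm]

theorem plane_equivariant_tau {Z : Subgroup (DihedralGroup n)}
    (β : Representation ℂ Z (Fin 2 → ℂ)) {f : (Fin 2 → ℂ) →ₗ[ℂ] V} {x : V}
    (hf : ∀ y, f y = y 0 • x + y 1 • (grp (tau n) : QuantumDouble (DihedralGroup n)) • x) {z : Z}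
    (hβ : β z = Matrix.toLin' !![0, 1; 1, 0]) (y : Fin 2 → ℂ) :
    (grp (tau n) : QuantumDouble (DihedralGroup n)) • f y = f (β z y) := by
  have : SMulCommClass (QuantumDouble (DihedralGroup n)) ℂ V := IsScalarTower.to_smulCommClass'
  rw [hf, smul_add, smul_comm, smul_comm _ (y 1), grp_tau_smul_grp_tau_smul, hβ, hf]
  simp [Matrix.mulVec, dotProduct, Fin.sum_univ_two, add_comm]

end Module

/-- It is enough to map one listed fibre into `V` nontrivially and equivariantly, in the degree of
its representative. Eigenvectors of the rotations or of `τ` in that degree provide the map. -/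
theorem exists_linearEquiv_aux (hn : Odd n) (V : Type v) [AddCommGroup V] [Module ℂ V]
    [Module (QuantumDouble (DihedralGroup n)) V]
    [IsScalarTower ℂ (QuantumDouble (DihedralGroup n)) V]
    [IsSimpleModule (QuantumDouble (DihedralGroup n)) V] :
    ∃ i : IrrepIdx n, ∀ ρ, i.Realizes ρ →
      Nonempty (V ≃ₗ[QuantumDouble (DihedralGroup n)] RepSpace ρ) := by
  have : SMulCommClass (QuantumDouble (DihedralGroup n)) ℂ V := IsScalarTower.to_smulCommClass'
  have : Nontrivial V := IsSimpleModule.nontrivial (QuantumDouble (DihedralGroup n)) V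
  have finish : ∀ (i : IrrepIdx n) (f : (Fin i.fibreDim → ℂ) →ₗ[ℂ] V), f ≠ 0 →
      (∀ w, (dual i.cls.rep : QuantumDouble (DihedralGroup n)) • f w = f w) →
      (∀ β, i.IsFibre β → ∀ (z : Subgroup.centralizer {i.cls.rep}) w,
        (grp (z : DihedralGroup n) : QuantumDouble (DihedralGroup n)) • f w = f (β z w)) →
      ∀ ρ, i.Realizes ρ → Nonempty (V ≃ₗ[QuantumDouble (DihedralGroup n)] RepSpace ρ) := by
    intro i f hf hd hg ρ hρ
    have := hρ.isSimpleModule hn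
    obtain ⟨β, hβ, -, hind⟩ := hρ.exists_isInducedFrom hn
    exact hind.nonempty_linearEquiv (alpha_conj_of_mem_conjugatesOf hn _) f hf hd (hg β hβ)
  have line : ∀ w : V, w ≠ 0 → ∃ f : (Fin 1 → ℂ) →ₗ[ℂ] V, f ≠ 0 ∧ ∀ x, f x = x 0 • w := by
    intro w hw
    refine ⟨(LinearMap.toSpanSingleton ℂ V w) ∘ₗ LinearMap.proj 0, fun h0 => hw ?_, fun x => rfl⟩
    simpa using DFunLike.congr_fun h0 1
  obtain ⟨c, u, hu, hcu⟩ := exists_dual_rep_smul_eq (n := n) (V := V) hn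
  cases c with
  | ident =>
    obtain ⟨j, w, hw, hr, hd⟩ := exists_rotation_eigenvector (n := n) hu
    have h1 := hd 1 (by simp) hcu
    have h1τ : (dual 1 : QuantumDouble (DihedralGroup n)) •
        (grp (tau n) : QuantumDouble (DihedralGroup n)) • w =
        (grp (tau n) : QuantumDouble (DihedralGroup n)) • w := by
      rw [← mul_smul, dual_mul_grp, mul_one, inv_mul_cancel, mul_smul, h1]
    -- If the rotations fix `w`, averaging over `τ` gives a one-dimensional representation;
    -- otherwise `w` and `τ w` have the eigenvalues of a plane representation.
    by_cases hj : j = 0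
    · obtain ⟨ε, x, hx, hxw, hτ⟩ := exists_tau_eigenvector (n := n) hw
      have hσ : (grp (sigma n) : QuantumDouble (DihedralGroup n)) • x = x := by
        rw [hxw, smul_add, smul_comm, sigma, grp_r_smul_grp_tau_smul, hr, hr, hj, zero_mul,
          zero_mul, AddChar.map_zero_eq_one, one_smul]
      have hdx : (dual 1 : QuantumDouble (DihedralGroup n)) • x = x := by
        rw [hxw, smul_add, smul_comm, h1, h1τ]
      obtain ⟨f, hf, hfx⟩ := line x hx
      refine ⟨.one ε, finish (.one ε) f hf (line_smul_eq hfx hdx) fun β hβ =>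
        equivariant_of_sigma_tau β f (fun z hz y => ?_) (fun z hz y => ?_)⟩
      · rw [← hz]
        exact line_equivariant β hfx (((hβ z).1 hz).trans (one_smul ℂ _).symm)
          (by rw [hz, hσ, one_smul]) y
      · rw [← hz]
        exact line_equivariant β hfx ((hβ z).2 hz) (by rw [hz, hτ]) y
    · obtain ⟨k, x, hx, hσ, hσ', hdx, hdx'⟩ : ∃ (k : RotIdx n) (x : V), x ≠ 0 ∧
          (grp (sigma n) : QuantumDouble (DihedralGroup n)) • x = omega n ^ (k.1 : ℤ) • x ∧
          (grp (sigma n) : QuantumDouble (DihedralGroup n)) •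
            (grp (tau n) : QuantumDouble (DihedralGroup n)) • x = omega n ^ (-(k.1 : ℤ)) •
            (grp (tau n) : QuantumDouble (DihedralGroup n)) • x ∧
          (dual 1 : QuantumDouble (DihedralGroup n)) • x = x ∧
          (dual 1 : QuantumDouble (DihedralGroup n)) •
            (grp (tau n) : QuantumDouble (DihedralGroup n)) • x =
            (grp (tau n) : QuantumDouble (DihedralGroup n)) • x := by
        obtain ⟨k, hk⟩ := (eq_zero_or_rotIdx hn j).resolve_left hj
        have e1 : (grp (sigma n) : QuantumDouble (DihedralGroup n)) • w =
            (ZMod.stdAddChar j : ℂ) • w := by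
          rw [sigma, hr, mul_one]
        have e2 : (grp (sigma n) : QuantumDouble (DihedralGroup n)) •
            (grp (tau n) : QuantumDouble (DihedralGroup n)) • w = (ZMod.stdAddChar (-j) : ℂ) •
            (grp (tau n) : QuantumDouble (DihedralGroup n)) • w := by
          rw [sigma, grp_r_smul_grp_tau_smul, hr, smul_comm, mul_neg, mul_one]
        -- In the form `τ (τ w) ≠ 0` the hypothesis gives both `w ≠ 0` and `τ w ≠ 0`. The vector `x`
        -- is `w` if `j = k` and `τ w` if `j = -k`.
        rw [← grp_tau_smul_grp_tau_smul (n := n) w] at hw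
        rcases hk with rfl | rfl
        · refine ⟨k, w, fun h0 => hw (by simp [h0]), ?_, ?_, h1, h1τ⟩
          · rw [e1, omega_zpow, Int.cast_natCast]
          · rw [e2, omega_zpow, Int.cast_neg, Int.cast_natCast]
        · refine ⟨k, (grp (tau n) : QuantumDouble (DihedralGroup n)) • w,
            fun h0 => hw (by simp [h0]), ?_, ?_, h1τ, ?_⟩
          · rw [e2, omega_zpow, neg_neg, Int.cast_natCast]
          · rw [grp_tau_smul_grp_tau_smul, e1, omega_zpow, Int.cast_neg, Int.cast_natCast]
          · rw [grp_tau_smul_grp_tau_smul, h1]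
      let f : (Fin 2 → ℂ) →ₗ[ℂ] V := (LinearMap.toSpanSingleton ℂ V x) ∘ₗ LinearMap.proj 0 +
        (LinearMap.toSpanSingleton ℂ V ((grp (tau n) : QuantumDouble (DihedralGroup n)) • x)) ∘ₗ
          LinearMap.proj 1
      have hf : ∀ y, f y = y 0 • x + y 1 •
          (grp (tau n) : QuantumDouble (DihedralGroup n)) • x := fun y => rfl
      have hf0 : f ≠ 0 := by
        intro h0
        apply hx
        have := DFunLike.congr_fun h0 ![1, 0]
        rw [hf] at this
        simpa using this
      refine ⟨.two k, finish (.two k) f hf0 (fun y => ?_) fun β hβ =>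
        equivariant_of_sigma_tau β f (fun z hz y => ?_) (fun z hz y => ?_)⟩
      · exact plane_smul_eq hf hdx hdx' y
      · exact plane_equivariant_sigma β hf ((hβ z).1 hz) hσ hσ' y
      · exact plane_equivariant_tau β hf ((hβ z).2 hz) y
  | rot k =>
    obtain ⟨j, w, hw, hr, hd⟩ := exists_rotation_eigenvector (n := n) hu
    obtain ⟨l, rfl⟩ := exists_fin_cast_eq j
    have hdw := hd _ (by
      intro a
      simp [ClassIdx.rep, sigma_pow]) hcu
    obtain ⟨f, hf, hfw⟩ := line w hw
    refine ⟨.rot k l, finish (.rot k l) f hf (line_smul_eq hfw hdw) fun β hβ z => ?_⟩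
    · have hz : (z : DihedralGroup n) ∈ (ClassIdx.rot k).centraliser := by
        rw [← ClassIdx.centralizer_rep hn]
        exact z.2
      obtain ⟨m, -, hm⟩ := hz
      have hs : sigma n ∈ Subgroup.centralizer {(ClassIdx.rot k : ClassIdx n).rep} := by
        rw [Subgroup.mem_centralizer_singleton_iff, ClassIdx.rep, ← pow_succ, ← pow_succ']
      have hzs : z = (⟨sigma n, hs⟩ : Subgroup.centralizer {(ClassIdx.rot k : ClassIdx n).rep}) ^ m :=
        Subtype.ext hm
      have hb := hβ ⟨sigma n, hs⟩ rfl
      have h2 : β z = omega n ^ ((l : ℕ) * m) • 1 := by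
        rw [hzs]
        refine (map_pow β _ m).trans ((congrArg (· ^ m) hb).trans ?_)
        simp only [smul_pow, one_pow, pow_mul]
      refine line_equivariant β hfw h2 ?_
      rw [hm, sigma_pow, hr, ← zpow_natCast, omega_zpow]
      push_cast
      rfl
  | refl =>
    obtain ⟨ε, w, hw, hwu, hτ⟩ := exists_tau_eigenvector (n := n) hu
    have hdw : (dual (tau n) : QuantumDouble (DihedralGroup n)) • w = w := by
      have hcu' : (dual (tau n) : QuantumDouble (DihedralGroup n)) • u = u := hcu
      rw [hwu, smul_add, smul_comm, ← mul_smul (dual (tau n)), dual_mul_grp, inv_mul_cancel,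
        one_mul, mul_smul, hcu']
    obtain ⟨f, hf, hfw⟩ := line w hw
    refine ⟨.refl ε, finish (.refl ε) f hf (line_smul_eq hfw hdw) fun β hβ z y => ?_⟩
    · have hz : (z : DihedralGroup n) ∈ (ClassIdx.refl : ClassIdx n).centraliser := by
        rw [← ClassIdx.centralizer_rep hn]
        exact z.2
      rcases hz with hz | hz
      · have hz1 : z = 1 := Subtype.ext hz
        subst hz1
        refine (congrArg (fun a => a • f y) grp_one).trans ?_
        rw [one_smul]
        exact (congrArg (fun a : Module.End ℂ (Fin 1 → ℂ) => f (a y)) (map_one β)).symm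
      · refine line_equivariant β hfw (hβ z hz) ?_ y
        rw [show (z : DihedralGroup n) = tau n from hz, hτ]

theorem exists_linearEquiv (hn : Odd n) (V : Type v) [AddCommGroup V]
    [Module (QuantumDouble (DihedralGroup n)) V]
    [IsSimpleModule (QuantumDouble (DihedralGroup n)) V] :
    ∃ i : IrrepIdx n, ∀ ρ, i.Realizes ρ →
      Nonempty (V ≃ₗ[QuantumDouble (DihedralGroup n)] RepSpace ρ) := by
  let _ : Module ℂ V := Module.compHom V (algebraMap ℂ (QuantumDouble (DihedralGroup n)))
  have : IsScalarTower ℂ (QuantumDouble (DihedralGroup n)) V :=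
    ⟨fun c a v => by rw [Algebra.smul_def, mul_smul]; rfl⟩
  exact exists_linearEquiv_aux hn V

end DihedralOdd

/-! ### Counting the list and the isomorphism classes. -/

namespace DihedralOdd
open DihedralGroup QuantumDouble
variable {n : ℕ}

theorem card_rotIdx : Nat.card (RotIdx n) = (n - 1) / 2 := by
  rw [Nat.subtype_card (Finset.Icc 1 ((n - 1) / 2)) fun x => Finset.mem_Icc, Nat.card_Icc,
    Nat.add_sub_cancel]

instance : Finite (RotIdx n) :=
  Set.Finite.subset (Set.finite_Iic ((n - 1) / 2)) fun _ hk => hk.2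

theorem ne_two_of_odd (hn : Odd n) : n ≠ 2 := by
  rintro rfl
  exact absurd hn (by decide)

theorem card_units_int : Nat.card ℤˣ = 2 := by
  rw [Nat.card_eq_fintype_card, Fintype.card_units_int]

namespace IrrepIdx

/-- The four families of labels. -/
def equivSum : ℤˣ ⊕ RotIdx n ⊕ (RotIdx n × Fin n) ⊕ ℤˣ ≃ IrrepIdx n where
  toFun
    | .inl ε => one ε
    | .inr (.inl k) => two k
    | .inr (.inr (.inl (k, j))) => rot k j
    | .inr (.inr (.inr ε)) => refl ε
  invFun
    | one ε => .inl ε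
    | two k => .inr (.inl k)
    | rot k j => .inr (.inr (.inl (k, j)))
    | refl ε => .inr (.inr (.inr ε))
  left_inv x := by rcases x with _ | _ | _ | _ <;> rfl
  right_inv x := by cases x <;> rfl

theorem card_one : Nat.card {i : IrrepIdx n // i.cls = .ident ∧ i.dim = 1} = 2 := by
  rw [← card_units_int]
  refine (Nat.card_congr (Equiv.ofBijective (fun ε => ⟨one ε, rfl, rfl⟩) ⟨?_, ?_⟩)).symm
  · rintro ε ε' h
    cases h
    rfl
  · rintro ⟨i, h1, h2⟩
    cases i with
    | one ε => exact ⟨ε, rfl⟩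
    | two k => cases h2
    | rot k j => cases h1
    | refl ε => cases h1

theorem card_two : Nat.card {i : IrrepIdx n // i.cls = .ident ∧ i.dim = 2} = (n - 1) / 2 := by
  rw [← card_rotIdx]
  refine (Nat.card_congr (Equiv.ofBijective (fun k => ⟨two k, rfl, rfl⟩) ⟨?_, ?_⟩)).symm
  · rintro k k' h
    cases h
    rfl
  · rintro ⟨i, h1, h2⟩
    cases i with
    | one ε => cases h2
    | two k => exact ⟨k, rfl⟩
    | rot k j => cases h1
    | refl ε => cases h1

theorem card_rot (hn : Odd n) :
    Nat.card {i : IrrepIdx n // (∃ k, i.cls = .rot k) ∧ i.dim = 2} = n * (n - 1) / 2 := by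
  have h0 : Nat.card (RotIdx n × Fin n) = n * (n - 1) / 2 := by
    rw [Nat.card_prod, card_rotIdx, Nat.card_fin]
    obtain ⟨m, rfl⟩ := hn
    rw [Nat.add_sub_cancel, Nat.mul_div_cancel_left _ two_pos, mul_left_comm,
      Nat.mul_div_cancel_left _ two_pos, mul_comm]
  rw [← h0]
  refine (Nat.card_congr (Equiv.ofBijective (fun k => ⟨rot k.1 k.2, ⟨k.1, rfl⟩, rfl⟩)
    ⟨?_, ?_⟩)).symm
  · rintro ⟨k, j⟩ ⟨k', j'⟩ h
    cases h
    rfl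
  · rintro ⟨i, ⟨k', h1⟩, h2⟩
    cases i with
    | one ε => cases h1
    | two k => cases h1
    | rot k j => exact ⟨(k, j), rfl⟩
    | refl ε => cases h1

theorem card_refl : Nat.card {i : IrrepIdx n // i.cls = .refl ∧ i.dim = n} = 2 := by
  rw [← card_units_int]
  refine (Nat.card_congr (Equiv.ofBijective (fun ε => ⟨refl ε, rfl, rfl⟩) ⟨?_, ?_⟩)).symm
  · rintro ε ε' h
    cases h
    rfl
  · rintro ⟨i, h1, h2⟩
    cases i with
    | one ε => cases h1
    | two k => cases h1
    | rot k j => cases h1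
    | refl ε => exact ⟨ε, rfl⟩

theorem card_dim_eq_one (hn : n ≠ 1) : Nat.card {i : IrrepIdx n // i.dim = 1} = 2 := by
  rw [← card_one (n := n)]
  refine Nat.card_congr (Equiv.subtypeEquivRight fun i => ?_)
  cases i <;> simp [dim, cls, hn]

/-- The two exclusions keep dimension `n` apart from the dimensions `1` and `2` of the other
families. -/
theorem card_dim_eq_self (h1 : n ≠ 1) (h2 : n ≠ 2) :
    Nat.card {i : IrrepIdx n // i.dim = n} = 2 := by
  rw [← card_refl (n := n)]
  refine Nat.card_congr (Equiv.subtypeEquivRight fun i => ?_)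
  cases i <;> simp [dim, cls, h1.symm, h2.symm]

theorem card_dim_eq_two (hn : Odd n) :
    Nat.card {i : IrrepIdx n // i.dim = 2} = (n ^ 2 - 1) / 2 := by
  have hn2 := ne_two_of_odd hn
  have h0 : Nat.card (RotIdx n ⊕ RotIdx n × Fin n) = (n ^ 2 - 1) / 2 := by
    rw [Nat.card_sum, Nat.card_prod, card_rotIdx, Nat.card_fin]
    obtain ⟨m, rfl⟩ := hn
    rw [Nat.add_sub_cancel, Nat.mul_div_cancel_left _ two_pos,
      show (2 * m + 1) ^ 2 = 2 * (m + m * (2 * m + 1)) + 1 by ring, Nat.add_sub_cancel,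
      Nat.mul_div_cancel_left _ two_pos]
  rw [← h0]
  refine (Nat.card_congr (Equiv.ofBijective (Sum.elim (fun k => ⟨two k, rfl⟩)
    (fun k => ⟨rot k.1 k.2, rfl⟩)) ⟨?_, ?_⟩)).symm
  · rintro (k | ⟨k, j⟩) (k' | ⟨k', j'⟩) h <;> cases h <;> rfl
  · rintro ⟨i, h⟩
    cases i with
    | one ε => cases h
    | two k => exact ⟨.inl k, rfl⟩
    | rot k j => exact ⟨.inr (k, j), rfl⟩
    | refl ε => exact absurd h hn2

theorem sum_dim_sq (hn : Odd n) : (∑ᶠ i : IrrepIdx n, i.dim ^ 2) = 4 * n ^ 2 := by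
  have := Fintype.ofFinite (RotIdx n)
  have hc : Fintype.card (RotIdx n) = (n - 1) / 2 := by
    rw [← Nat.card_eq_fintype_card, card_rotIdx]
  rw [← finsum_comp_equiv equivSum, finsum_eq_sum_of_fintype]
  simp only [Fintype.sum_sum_type, equivSum, Equiv.coe_fn_mk, dim, Finset.sum_const,
    Finset.card_univ, Fintype.card_units_int, Fintype.card_prod, hc, Fintype.card_fin]
  obtain ⟨m, rfl⟩ := hn
  rw [Nat.add_sub_cancel, Nat.mul_div_cancel_left _ two_pos]
  simp only [smul_eq_mul]
  ring

end IrrepIdx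

end DihedralOdd

theorem RepSpace.dim_eq_of_linearEquiv {A : Type u} [Ring A] [Algebra ℂ A] {d d' : ℕ}
    {φ : A →ₐ[ℂ] Matrix (Fin d) (Fin d) ℂ} {ψ : A →ₐ[ℂ] Matrix (Fin d') (Fin d') ℂ}
    (e : RepSpace φ ≃ₗ[A] RepSpace ψ) : d = d' := by
  have h1 := (e.restrictScalars ℂ).finrank_eq
  change Module.finrank ℂ (Fin d → ℂ) = Module.finrank ℂ (Fin d' → ℂ) at h1
  simpa using h1

/-- Isomorphism classes of irreducible representations are counted by any complete list of
pairwise non-isomorphic ones. -/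
theorem card_irrepClasses {A : Type u} [Ring A] [Algebra ℂ A] {I : Type*} {dim : I → ℕ}
    (ρ : ∀ i, A →ₐ[ℂ] Matrix (Fin (dim i)) (Fin (dim i)) ℂ)
    (hs : ∀ i, IsSimpleModule A (RepSpace (ρ i)))
    (hinj : ∀ i j, Nonempty (RepSpace (ρ i) ≃ₗ[A] RepSpace (ρ j)) → i = j)
    (hsurj : ∀ (V : Type) [AddCommGroup V] [Module A V], IsSimpleModule A V →
      ∃ i, Nonempty (V ≃ₗ[A] RepSpace (ρ i))) (d : ℕ) :
    Nat.card (IrrepClasses A d) = Nat.card {i // dim i = d} ∧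
      ((∀ i, dim i ≠ d) → IsEmpty (IrrepClasses A d)) := by
  let F : {i // dim i = d} → IrrepClasses A d := fun x => Quotient.mk (irrepSetoid A d)
    (x.2 ▸ (⟨ρ x.1, hs x.1⟩ : {φ : A →ₐ[ℂ] Matrix (Fin (dim x.1)) (Fin (dim x.1)) ℂ //
      IsSimpleModule A (RepSpace φ)}))
  have hF : Function.Surjective F := by
    intro q
    induction q using Quotient.inductionOn with
    | h φ =>
      obtain ⟨φ, hφ⟩ := φ
      obtain ⟨i, ⟨e⟩⟩ := hsurj (RepSpace φ) hφ
      obtain rfl := RepSpace.dim_eq_of_linearEquiv e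
      exact ⟨⟨i, rfl⟩, Quotient.sound ⟨e.symm⟩⟩
  refine ⟨(Nat.card_congr (Equiv.ofBijective F ⟨?_, hF⟩)).symm, fun h => ⟨fun q => ?_⟩⟩
  · rintro ⟨i, rfl⟩ ⟨j, hj⟩ h
    -- With `d` a free variable, the transport along `dim j = d` becomes trivial and equality of
    -- classes yields an isomorphism.
    have key : ∀ (d : ℕ) (hj : dim j = d) (φ : {φ : A →ₐ[ℂ] Matrix (Fin d) (Fin d) ℂ //
        IsSimpleModule A (RepSpace φ)}), Quotient.mk (irrepSetoid A d) φ =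
        Quotient.mk (irrepSetoid A d) (hj ▸ (⟨ρ j, hs j⟩ :
          {φ : A →ₐ[ℂ] Matrix (Fin (dim j)) (Fin (dim j)) ℂ //
            IsSimpleModule A (RepSpace φ)})) →
        Nonempty (RepSpace φ.1 ≃ₗ[A] RepSpace (ρ j)) := by
      rintro d rfl φ hφ
      exact Quotient.exact hφ
    exact Subtype.ext (hinj i j (key _ hj _ h))
  · obtain ⟨x, -⟩ := hF q
    exact h x.1 x.2

theorem mainTheorem2 (n : ℕ) [NeZero n] (hn : Odd n) :
    -- conjugacy classes, centralisers and conjugating elements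
    (Function.Bijective fun c : DihedralOdd.ClassIdx n => ConjClasses.mk c.rep) ∧
    (∀ c : DihedralOdd.ClassIdx n,
      conjugatesOf c.rep = c.elements ∧
      ((Subgroup.centralizer {c.rep} : Subgroup (DihedralGroup n)) : Set (DihedralGroup n)) =
        c.centraliser ∧
      c.alpha c.rep = 1 ∧
      ∀ s ∈ c.elements, s = c.alpha s * c.rep * (c.alpha s)⁻¹) ∧
    -- the listed matrices define representations, which are irreducible, induced from the stated
    -- class, pairwise non-isomorphic, and exhaust all irreducible modules
    (∃ ρ : (i : DihedralOdd.IrrepIdx n) →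
        QuantumDouble (DihedralGroup n) →ₐ[ℂ] Matrix (Fin i.dim) (Fin i.dim) ℂ,
      (∀ i ρ', i.Realizes ρ' ↔ ρ' = ρ i) ∧
      (∀ i, IsSimpleModule (QuantumDouble (DihedralGroup n)) (RepSpace (ρ i))) ∧
      (∀ i, ∃ β : Representation ℂ (Subgroup.centralizer {i.cls.rep}) (Fin i.fibreDim → ℂ),
        i.IsFibre β ∧ β.IsIrreducible ∧ IsInducedFrom (ρ i) i.cls.rep i.cls.alpha β) ∧
      (∀ i j, Nonempty (RepSpace (ρ i) ≃ₗ[QuantumDouble (DihedralGroup n)] RepSpace (ρ j)) →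
        i = j) ∧
      (∀ (V : Type u) [AddCommGroup V] [Module (QuantumDouble (DihedralGroup n)) V],
        IsSimpleModule (QuantumDouble (DihedralGroup n)) V →
          ∃ i, Nonempty (V ≃ₗ[QuantumDouble (DihedralGroup n)] RepSpace (ρ i)))) ∧
    -- the numbers of listed representations, by class and dimension
    Nat.card {i : DihedralOdd.IrrepIdx n // i.cls = .ident ∧ i.dim = 1} = 2 ∧
    Nat.card {i : DihedralOdd.IrrepIdx n // i.cls = .ident ∧ i.dim = 2} = (n - 1) / 2 ∧
    Nat.card {i : DihedralOdd.IrrepIdx n // (∃ k, i.cls = .rot k) ∧ i.dim = 2} =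
      n * (n - 1) / 2 ∧
    Nat.card {i : DihedralOdd.IrrepIdx n // i.cls = .refl ∧ i.dim = n} = 2 ∧
    -- the numbers of isomorphism classes of irreducible representations, by dimension
    (n ≠ 1 →
      Nat.card (IrrepClasses (QuantumDouble (DihedralGroup n)) 1) = 2 ∧
      Nat.card (IrrepClasses (QuantumDouble (DihedralGroup n)) 2) = (n ^ 2 - 1) / 2 ∧
      Nat.card (IrrepClasses (QuantumDouble (DihedralGroup n)) n) = 2 ∧
      ∀ d : ℕ, d ≠ 1 → d ≠ 2 → d ≠ n →
        IsEmpty (IrrepClasses (QuantumDouble (DihedralGroup n)) d)) ∧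
    -- the sum of the squares of the dimensions
    ((∑ᶠ i : DihedralOdd.IrrepIdx n, i.dim ^ 2) = 4 * n ^ 2 ∧
      Nat.card (DihedralGroup n) ^ 2 = 4 * n ^ 2 ∧
      Module.finrank ℂ (QuantumDouble (DihedralGroup n)) = 4 * n ^ 2) := by
  choose ρ hρ using DihedralOdd.IrrepIdx.exists_realizes hn
  have hsimple := fun i => (hρ i).isSimpleModule hn
  have hinj : ∀ i j, Nonempty (RepSpace (ρ i) ≃ₗ[QuantumDouble (DihedralGroup n)]
      RepSpace (ρ j)) → i = j := fun i j ⟨e⟩ =>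
    DihedralOdd.IrrepIdx.eq_of_linearEquiv hn (hρ i) (hρ j) e
  refine ⟨DihedralOdd.ClassIdx.bijective_mk_rep hn, fun c =>
    ⟨DihedralOdd.ClassIdx.conjugatesOf_rep hn c, DihedralOdd.ClassIdx.centralizer_rep hn c,
      DihedralOdd.ClassIdx.alpha_rep c, DihedralOdd.ClassIdx.eq_alpha_conj hn c⟩,
    ⟨ρ, fun i ρ' => ⟨fun h => h.unique (hρ i), ?_⟩, hsimple,
      fun i => (hρ i).exists_isInducedFrom hn, hinj, ?_⟩,
    DihedralOdd.IrrepIdx.card_one, DihedralOdd.IrrepIdx.card_two,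
    DihedralOdd.IrrepIdx.card_rot hn, DihedralOdd.IrrepIdx.card_refl, fun h1 => ?_,
    DihedralOdd.IrrepIdx.sum_dim_sq hn, ?_, ?_⟩
  · rintro rfl
    exact hρ i
  · intro V _ _ hV
    obtain ⟨i, hi⟩ := DihedralOdd.exists_linearEquiv hn V
    exact ⟨i, hi _ (hρ i)⟩
  · have hcard := card_irrepClasses ρ hsimple hinj fun V _ _ hV => by
      obtain ⟨i, hi⟩ := DihedralOdd.exists_linearEquiv hn V
      exact ⟨i, hi _ (hρ i)⟩
    refine ⟨(hcard 1).1.trans (DihedralOdd.IrrepIdx.card_dim_eq_one h1),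
      (hcard 2).1.trans (DihedralOdd.IrrepIdx.card_dim_eq_two hn),
      (hcard n).1.trans
        (DihedralOdd.IrrepIdx.card_dim_eq_self h1 (DihedralOdd.ne_two_of_odd hn)),
      fun d hd1 hd2 hdn => (hcard d).2 fun i => ?_⟩
    cases i with
    | one ε => exact hd1.symm
    | two k => exact hd2.symm
    | rot k j => exact hd2.symm
    | refl ε => exact hdn.symm
  · rw [DihedralGroup.nat_card]
    ring
  · change Module.finrank ℂ (DihedralGroup n → DihedralGroup n → ℂ) = _
    simp only [Module.finrank_pi_fintype, Module.finrank_self, Finset.sum_const, Finset.card_univ,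
      DihedralGroup.card, smul_eq_mul]
    ring
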